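/- Let $n\ge 8$ and $d=\lfloor\frac{n-4}{2}\rfloor$. There is a constant $C>0$ depending only on $n$ with the following property. Let $h=(h_{ij})$ be a smooth symmetric two-tensor on a ball around $0\in\mathbb R^n$ with $\sum_j h_{ij}(x)x_j=0$ for all $x$ and $i$, and $\operatorname{tr}h=O(|x|^{2d+2})$ as $x\to0$. Let $H^{(k)}_{ij}(x)=\sum_{|\alpha|=k}h_{ij,\alpha}x^\alpha$ $(2\le k\le d)$ be the homogeneous parts of the Taylor polynomial of $h$ at $0$, let $H=\sum_{k=2}^dH^{(k)}$, so that $h=H+O(|x|^{d+1})$, and put $|H^{(k)}|^2=\sum_{i,j}\sum_{|\alpha|=k}|h_{ij,\alpha}|^2$. Let $\chi:\mathbb R\to[0,\infty)$ be smooth with $\chi(s)=1$ for $s\le\frac43$ and $\chi(s)=0$ for $s\ge\frac53$, and put $\chi_\delta(x)=\chi(|x|/\delta)$. Let $\epsilon,\delta>0$, let $$u_\epsilon(x)=\Big(\frac{\epsilon}{\epsilon^2+|x|^2}\Big)^{\frac{n-4}{2}},\qquad g_c=u_\epsilon^{\frac4{n-4}}g_e,$$ where $g_e$ is the Euclidean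 metric (so $g_c$ is a round sphere metric), and let $X$ be a smooth vector field on $\mathbb R^n$ such that $\chi_\delta H=T+S$ with $$S=\mathcal L_Xg_e-\tfrac2n(\operatorname{div}X)\,g_e,\qquad \operatorname{tr}T=\operatorname{tr}S=0,\qquad \operatorname{div}\big(u_\epsilon^{\frac{2n}{n-4}}T\big)=0 .$$ Put $\bar T=u_\epsilon^{\frac4{n-4}}T$, and let $DW_{g_c}[\bar T]=\frac{d}{dt}\big|_{t=0}W_{g_c+t\bar T}$ be the linearization at $g_c$ in the direction $\bar T$ of the Weyl tensor, regarded as a covariant four-tensor. Write $B_s=\{x\in\mathbb R^n:|x|<s\}$. Then $$\int_{B_{2r}\setminus B_r}|DW_{g_c}[\bar T]|^2_{g_c}\,dv_{g_c}\ \ge\ \frac1C\,\epsilon^{n-4}\sum_{k=2}^d|H^{(k)}|^2\,r^{-n+2k+4}\qquad\text{for all } \epsilon<r\le\delta,$$ and, if $\delta\ge2\epsilon$, $$\int_{B_\delta}|DW_{g_c}[\bar T]|^2_{g_c}\,dv_{g_c}\ \ge\ \frac1C\,\epsilon^{n-4}\sum_{k=2}^d|H^{(k)}|^2\int_{B_\delta}(\epsilon+|x|)^{-2n+2k+4}\,dx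 .$$ -/

import Mathlib

open MeasureTheory Asymptotics
open scoped Topology ContDiff

noncomputable section

namespace WeylBubble

/-- Euclidean space `ℝⁿ`. -/
abbrev Pt (n : ℕ) : Type := EuclideanSpace ℝ (Fin n)

/-- A covariant two-tensor field on `ℝⁿ`, given by its components in the standard coordinates. -/
abbrev Tensor2 (n : ℕ) : Type := Pt n → Matrix (Fin n) (Fin n) ℝ

variable {n : ℕ}

/-- The partial derivative `∂ᵢ f` in the standard coordinates. -/
def pd (i : Fin n) (f : Pt n → ℝ) (x : Pt n) : ℝ :=
  fderiv ℝ f x (EuclideanSpace.single i 1)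

/-! ### Curvature of a metric `g` in the standard coordinates -/

/-- Christoffel symbols `Γᵐᵢⱼ = ½ gᵐˡ (∂ᵢ gⱼₗ + ∂ⱼ gᵢₗ - ∂ₗ gᵢⱼ)`. -/
def christoffel (g : Tensor2 n) (x : Pt n) (m i j : Fin n) : ℝ :=
  (1 / 2) * ∑ l, (g x)⁻¹ m l *
    (pd i (fun y => g y j l) x + pd j (fun y => g y i l) x - pd l (fun y => g y i j) x)

/-- The component `m` of `R(∂ᵢ, ∂ⱼ)∂ₖ = ∇ᵢ∇ⱼ∂ₖ - ∇ⱼ∇ᵢ∂ₖ`. -/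
def riemannUp (g : Tensor2 n) (x : Pt n) (i j k m : Fin n) : ℝ :=
  pd i (fun y => christoffel g y m j k) x - pd j (fun y => christoffel g y m i k) x
    + ∑ p, (christoffel g x p j k * christoffel g x m i p
      - christoffel g x p i k * christoffel g x m j p)

/-- The Riemann tensor `Rmᵢⱼₖₗ = g(R(∂ᵢ, ∂ⱼ)∂ₖ, ∂ₗ)`; with this sign a metric of constant sectional
curvature `c` has `Rmᵢⱼₖₗ = c (gᵢₗ gⱼₖ - gᵢₖ gⱼₗ)`. -/
def riemann (g : Tensor2 n) (x : Pt n) (i j k l : Fin n) : ℝ :=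
  ∑ m, riemannUp g x i j k m * g x m l

/-- The Ricci tensor `Ricⱼₖ = gⁱˡ Rmᵢⱼₖₗ`. -/
def ricci (g : Tensor2 n) (x : Pt n) (j k : Fin n) : ℝ :=
  ∑ i, ∑ l, (g x)⁻¹ i l * riemann g x i j k l

/-- The scalar curvature. -/
def scalarCurv (g : Tensor2 n) (x : Pt n) : ℝ :=
  ∑ j, ∑ k, (g x)⁻¹ j k * ricci g x j k

/-- The Schouten tensor `A = (Ric - R g / (2(n-1))) / (n-2)`. -/
def schouten (g : Tensor2 n) (x : Pt n) (i j : Fin n) : ℝ :=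
  1 / ((n : ℝ) - 2) * (ricci g x i j - 1 / (2 * ((n : ℝ) - 1)) * scalarCurv g x * g x i j)

/-- The Weyl tensor `W = Rm - A ⧀ g` (all indices down), where
`(A ⧀ g)ᵢⱼₖₗ = Aᵢₗ gⱼₖ + Aⱼₖ gᵢₗ - Aᵢₖ gⱼₗ - Aⱼₗ gᵢₖ` is the Kulkarni-Nomizu product. -/
def weyl (g : Tensor2 n) (x : Pt n) (i j k l : Fin n) : ℝ :=
  riemann g x i j k l
    - (schouten g x i l * g x j k + schouten g x j k * g x i l
      - schouten g x i k * g x j l - schouten g x j l * g x i k)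

/-- The linearization of the Weyl tensor at `g` in the direction `h`:
`DW_g[h] = d/dt W_{g + t h}` at `t = 0`. -/
def linWeyl (g h : Tensor2 n) (x : Pt n) (i j k l : Fin n) : ℝ :=
  deriv (fun t : ℝ => weyl (fun y => g y + t • h y) x i j k l) 0

/-- The squared norm `|A|²_g = gⁱᵃ gʲᵇ gᵏᶜ gˡᵉ Aᵢⱼₖₗ A_{abce}` of a covariant four-tensor at `x`. -/
def normSq4 (g : Tensor2 n) (x : Pt n) (A : Fin n → Fin n → Fin n → Fin n → ℝ) : ℝ :=
  ∑ i, ∑ j, ∑ k, ∑ l, ∑ a, ∑ b, ∑ c, ∑ e,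
    (g x)⁻¹ i a * (g x)⁻¹ j b * (g x)⁻¹ k c * (g x)⁻¹ l e * A i j k l * A a b c e

/-- The integral `∫_U f dv_g`, where `dv_g = √(det g) dx`. -/
def volIntegral (g : Tensor2 n) (U : Set (Pt n)) (f : Pt n → ℝ) : ℝ :=
  ∫ x in U, f x * Real.sqrt (g x).det

/-! ### The bubble and the round metric -/

/-- The bubble `u_ε(x) = (ε / (ε² + |x|²))^((n-4)/2)`. -/
def bubble (ε : ℝ) (x : Pt n) : ℝ :=
  (ε / (ε ^ 2 + ‖x‖ ^ 2)) ^ (((n : ℝ) - 4) / 2)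

/-- The tensor `u_ε^(4/(n-4)) T`. -/
def bubbleScale (ε : ℝ) (T : Tensor2 n) : Tensor2 n :=
  fun x => (bubble ε x) ^ (4 / ((n : ℝ) - 4)) • T x

/-- The round metric `g_c = u_ε^(4/(n-4)) g_e`. -/
def roundMetric (n : ℕ) (ε : ℝ) : Tensor2 n :=
  bubbleScale ε (fun _ => 1)

/-! ### The tensor `h`, its Taylor polynomial `H`, and the cutoff -/

/-- `h` is a smooth symmetric two-tensor on the ball `B_ρ(0)` with `h_{ij}(x) x_j = 0` and
`tr h = O(|x|^(2d+2))` (the logarithm of a metric in conformal normal coordinates). -/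
structure IsNormalTensor (d : ℕ) (ρ : ℝ) (h : Tensor2 n) : Prop where
  radius_pos : 0 < ρ
  smooth : ∀ i j, ContDiffOn ℝ ∞ (fun x => h x i j) (Metric.ball 0 ρ)
  symm : ∀ x ∈ Metric.ball (0 : Pt n) ρ, (h x).IsSymm
  radial : ∀ x ∈ Metric.ball (0 : Pt n) ρ, ∀ i, ∑ j, h x i j * x j = 0
  trace : (fun x => (h x).trace) =O[𝓝 0] fun x => ‖x‖ ^ (2 * d + 2)

/-- A matrix of polynomials as a two-tensor field. -/
def polyTensor (H : Matrix (Fin n) (Fin n) (MvPolynomial (Fin n) ℝ)) : Tensor2 n :=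
  fun x => Matrix.of fun i j => MvPolynomial.eval (fun a => x a) (H i j)

/-- `H` is the part of degree `2, …, d` of the Taylor polynomial of `h` at the origin, and
`h = H + O(|x|^(d+1))`. -/
structure IsTaylorPart (d : ℕ) (h : Tensor2 n)
    (H : Matrix (Fin n) (Fin n) (MvPolynomial (Fin n) ℝ)) : Prop where
  degree : ∀ i j, ∀ α ∈ (H i j).support, 2 ≤ α.degree ∧ α.degree ≤ d
  approx : ∀ i j, (fun x => h x i j - polyTensor H x i j) =O[𝓝 0] fun x => ‖x‖ ^ (d + 1)

/-- `|H⁽ᵏ⁾|²`: the sum of the squares of all coefficients of the homogeneous part of degree `k`. -/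
def coeffSq (H : Matrix (Fin n) (Fin n) (MvPolynomial (Fin n) ℝ)) (k : ℕ) : ℝ :=
  ∑ i, ∑ j, ∑ α ∈ (H i j).support with α.degree = k, (MvPolynomial.coeff α (H i j)) ^ 2

/-- A smooth nonnegative `χ` equal to `1` on `(-∞, 4/3]` and to `0` on `[5/3, ∞)`. -/
structure IsCutoff (χ : ℝ → ℝ) : Prop where
  smooth : ContDiff ℝ ∞ χ
  nonneg : ∀ s, 0 ≤ χ s
  one : ∀ s, s ≤ 4 / 3 → χ s = 1
  zero : ∀ s, 5 / 3 ≤ s → χ s = 0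

/-! ### The splitting `χ_δ H = T + S` -/

/-- The divergence of a vector field with respect to the Euclidean metric. -/
def divVec (X : Pt n → Pt n) (x : Pt n) : ℝ :=
  ∑ i, pd i (fun y => X y i) x

/-- The conformal Killing operator `L_X g_e - (2/n) (div X) g_e`. -/
def conformalKilling (X : Pt n → Pt n) : Tensor2 n :=
  fun x => Matrix.of fun i j =>
    pd i (fun y => X y j) x + pd j (fun y => X y i) x
      - 2 / (n : ℝ) * divVec X x * (1 : Matrix (Fin n) (Fin n) ℝ) i j

/-- `χ_δ H = T + S` with `S = L_X g_e - (2/n) (div X) g_e` for a smooth vector field `X`, both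
summands traceless, and `div (u_ε^(2n/(n-4)) T) = 0`. -/
structure IsSplitting (ε δ : ℝ) (χ : ℝ → ℝ) (H : Tensor2 n)
    (X : Pt n → Pt n) (T S : Tensor2 n) : Prop where
  smooth : ContDiff ℝ ∞ X
  split : ∀ x, χ (‖x‖ / δ) • H x = T x + S x
  trace_T : ∀ x, (T x).trace = 0
  div_T : ∀ x i,
    ∑ j, pd j (fun y => (bubble ε y) ^ (2 * (n : ℝ) / ((n : ℝ) - 4)) * T y i j) x = 0
  trace_S : ∀ x, (S x).trace = 0
  eq_S : S = conformalKilling X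

end WeylBubble

end

open WeylBubble

/-! The weighted energy of `T` depends only on the polynomial tensor `H`, and on polynomial tensors
of bounded degree the estimate follows from injectivity of a linear operator, compactness and
scaling.

Reduction to `H`. The covariant Weyl tensor satisfies `W(e^{2f} g) = e^{2f} W(g)`
(`weyl_conformal`). Hence the linearization at the conformally flat round metric is a multiple of
the linearization at the Euclidean metric (`linWeyl_conformallyFlat`), and collecting conformal
weights turns the integrand into `(ε / (ε² + |x|²))^(n-4)` times the flat quantity `flatWeylSq T`
(`integrand_eq`). The flat linearization annihilates conformal Killing images
(`flatWeyl_conformalKilling`), so `T` may be replaced by `χ_δ H`, which is `H` itself for `|x| <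
4δ/3` (`volIntegral_eq`).

Injectivity. The Taylor polynomial `H` inherits symmetry, `H x = 0` and, since the trace of `h`
vanishes to high order, `tr H = 0` (`isRadialFree_of_isTaylorPart`). If the flat linearized Weyl
tensor of such a tensor, homogeneous of degree `m + 2`, vanishes, then its linearized Riemann tensor
is the Kulkarni-Nomizu product of some `P` with the Euclidean metric. Contractions with `x`, traces
and divergences show that `P(x, x)`, and afterwards each entry of `H`, is an eigenvector of `|x|² Δ`
on polynomials of degree `m + 2`, with eigenvalues outside the range `[0, k (k + n - 2)]` allowed
for degree `k = m + 2`. So both vanish (`eq_zero_of_linRiemann_eq_kulkarniNomizu`,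
`eq_zero_of_normSqPoly_mul_lap`). The homogeneous components of `H` are treated separately.

Coercivity. The energy on `1 ≤ |x| ≤ 5/4` is a positive continuous quadratic form on a
finite-dimensional space, hence bounded below by the coefficient norm (`exists_coercivity`). All
degrees are handled at once, and the substitution `x ↦ s x` preserves the space, so the same
constant serves every scale `s` (`le_integral_annulus_of_unit`). On such an annulus the bubble
weight is bounded below by its size at scale `s`, which gives the first inequality. The second
follows by summing over dyadic shells down to scale `ε` (`le_integral_ball`). -/

noncomputable section

namespace WeylBubble

variable {n : ℕ}

/-! ### The algebraic Weyl projection -/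

/-- The Kulkarni-Nomizu product of two symmetric two-tensors. -/
def kulkarniNomizu (B g : Matrix (Fin n) (Fin n) ℝ) (i j k l : Fin n) : ℝ :=
  B i l * g j k + B j k * g i l - B i k * g j l - B j l * g i k

/-- The Ricci contraction of a four-tensor. -/
def ricciContr (g : Matrix (Fin n) (Fin n) ℝ) (R : Fin n → Fin n → Fin n → Fin n → ℝ)
    (j k : Fin n) : ℝ :=
  ∑ i, ∑ l, g⁻¹ i l * R i j k l

/-- The scalar contraction of a four-tensor. -/
def scalarContr (g : Matrix (Fin n) (Fin n) ℝ) (R : Fin n → Fin n → Fin n → Fin n → ℝ) : ℝ :=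
  ∑ j, ∑ k, g⁻¹ j k * ricciContr g R j k

/-- The Schouten contraction of a four-tensor. -/
def schoutenContr (g : Matrix (Fin n) (Fin n) ℝ) (R : Fin n → Fin n → Fin n → Fin n → ℝ)
    (i j : Fin n) : ℝ :=
  1 / ((n : ℝ) - 2) * (ricciContr g R i j - 1 / (2 * ((n : ℝ) - 1)) * scalarContr g R * g i j)

/-- The Weyl projection of a four-tensor. -/
def weylPart (g : Matrix (Fin n) (Fin n) ℝ) (R : Fin n → Fin n → Fin n → Fin n → ℝ)
    (i j k l : Fin n) : ℝ :=
  R i j k l - kulkarniNomizu (Matrix.of (schoutenContr g R)) g i j k l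

theorem weyl_eq_weylPart (g : Tensor2 n) (x : Pt n) :
    weyl g x = weylPart (g x) (riemann g x) := by
  rfl

theorem ricciContr_add (g : Matrix (Fin n) (Fin n) ℝ) (R R' : Fin n → Fin n → Fin n → Fin n → ℝ)
    (j k : Fin n) :
    ricciContr g (fun i j k l => R i j k l + R' i j k l) j k
      = ricciContr g R j k + ricciContr g R' j k := by
  simp only [ricciContr, mul_add, Finset.sum_add_distrib]

theorem ricciContr_smul (g : Matrix (Fin n) (Fin n) ℝ) (c : ℝ)
    (R : Fin n → Fin n → Fin n → Fin n → ℝ) (j k : Fin n) :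
    ricciContr g (fun i j k l => c * R i j k l) j k = c * ricciContr g R j k := by
  simp only [ricciContr, Finset.mul_sum, mul_left_comm]

theorem weylPart_add (g : Matrix (Fin n) (Fin n) ℝ) (R R' : Fin n → Fin n → Fin n → Fin n → ℝ)
    (i j k l : Fin n) :
    weylPart g (fun i j k l => R i j k l + R' i j k l) i j k l
      = weylPart g R i j k l + weylPart g R' i j k l := by
  simp only [weylPart, kulkarniNomizu, schoutenContr, scalarContr, ricciContr_add, mul_add,
    Finset.sum_add_distrib, Matrix.of_apply]
  ring

theorem weylPart_smul (g : Matrix (Fin n) (Fin n) ℝ) (c : ℝ)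
    (R : Fin n → Fin n → Fin n → Fin n → ℝ) (i j k l : Fin n) :
    weylPart g (fun i j k l => c * R i j k l) i j k l = c * weylPart g R i j k l := by
  simp only [weylPart, kulkarniNomizu, schoutenContr, scalarContr, ricciContr_smul,
    mul_left_comm _ c, ← Finset.mul_sum, Matrix.of_apply]
  ring

theorem sum_inv_mul {g : Matrix (Fin n) (Fin n) ℝ} (hg : IsUnit g.det) (i j : Fin n) :
    ∑ l, g⁻¹ i l * g l j = if i = j then 1 else 0 := by
  have := congrFun (congrFun (Matrix.nonsing_inv_mul g hg) i) j
  rwa [Matrix.mul_apply, Matrix.one_apply] at this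

theorem sum_mul_inv {g : Matrix (Fin n) (Fin n) ℝ} (hg : IsUnit g.det) (i j : Fin n) :
    ∑ l, g i l * g⁻¹ l j = if i = j then 1 else 0 := by
  have := congrFun (congrFun (Matrix.mul_nonsing_inv g hg) i) j
  rwa [Matrix.mul_apply, Matrix.one_apply] at this

theorem ricciContr_kulkarniNomizu {g B : Matrix (Fin n) (Fin n) ℝ} (hg : IsUnit g.det)
    (hs : g.IsSymm) (j k : Fin n) :
    ricciContr g (kulkarniNomizu B g) j k
      = ((n : ℝ) - 2) * B j k + (∑ i, ∑ l, g⁻¹ i l * B i l) * g j k := by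
  have e1 : ∑ i, ∑ l, g⁻¹ i l * (B i l * g j k) = (∑ i, ∑ l, g⁻¹ i l * B i l) * g j k := by
    simp only [Finset.sum_mul, mul_assoc]
  have e2 : ∑ i, ∑ l, g⁻¹ i l * (B j k * g i l) = (n : ℝ) * B j k := by
    have : ∀ i : Fin n, ∑ l, g⁻¹ i l * (B j k * g i l) = B j k := fun i => by
      simp only [mul_left_comm _ (B j k), ← Finset.mul_sum]
      simp only [fun l => hs.apply l i, sum_inv_mul hg, if_true, mul_one]
    simp [this]
  have e3 : ∑ i, ∑ l, g⁻¹ i l * (B i k * g j l) = B j k := by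
    have : ∀ i : Fin n, ∑ l, g⁻¹ i l * (B i k * g j l) = if i = j then B i k else 0 := fun i => by
      simp only [mul_left_comm _ (B i k), ← Finset.mul_sum]
      simp only [fun l => hs.apply l j, sum_inv_mul hg, mul_ite, mul_one, mul_zero]
    simp [this]
  have e4 : ∑ i, ∑ l, g⁻¹ i l * (B j l * g i k) = B j k := by
    rw [Finset.sum_comm]
    have : ∀ l : Fin n, ∑ i, g⁻¹ i l * (B j l * g i k) = if k = l then B j l else 0 := fun l => by
      have : ∀ i, g⁻¹ i l * (B j l * g i k) = B j l * (g k i * g⁻¹ i l) := fun i => by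
        rw [hs.apply]; ring
      simp only [this, ← Finset.mul_sum, sum_mul_inv hg, mul_ite, mul_one, mul_zero]
    simp [this]
  simp only [ricciContr, kulkarniNomizu, mul_sub, mul_add, Finset.sum_sub_distrib,
    Finset.sum_add_distrib, e1, e2, e3, e4]
  ring

theorem sum_inv_mul_self {g : Matrix (Fin n) (Fin n) ℝ} (hg : IsUnit g.det) (hs : g.IsSymm) :
    ∑ i, ∑ l, g⁻¹ i l * g i l = (n : ℝ) := by
  have : ∀ i, ∑ l, g⁻¹ i l * g i l = 1 := fun i => by
    simp only [fun l => hs.apply l i, sum_inv_mul hg, if_true]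
  simp [this]

/-- The Weyl projection annihilates the Kulkarni-Nomizu products with the metric. -/
theorem weylPart_kulkarniNomizu (hn : 3 ≤ n) {g B : Matrix (Fin n) (Fin n) ℝ}
    (hg : IsUnit g.det) (hs : g.IsSymm) (i j k l : Fin n) :
    weylPart g (kulkarniNomizu B g) i j k l = 0 := by
  have h3 : (3 : ℝ) ≤ n := by exact_mod_cast hn
  have h1 : (n : ℝ) - 1 ≠ 0 := by linarith
  have h2 : (n : ℝ) - 2 ≠ 0 := by linarith
  set τ := ∑ i, ∑ l, g⁻¹ i l * B i l with hτ
  have hsc : scalarContr g (kulkarniNomizu B g) = (2 * (n : ℝ) - 2) * τ := by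
    simp only [scalarContr, ricciContr_kulkarniNomizu hg hs, mul_add, Finset.sum_add_distrib,
      mul_left_comm _ ((n : ℝ) - 2), mul_left_comm _ τ, ← Finset.mul_sum, ← hτ,
      sum_inv_mul_self hg hs]
    ring
  -- The normalization of the Schouten tensor inverts `B ↦ (n - 2) B + (tr B) g`, so it recovers `B`
  -- exactly.
  have hA : schoutenContr g (kulkarniNomizu B g) = B := by
    ext i j
    rw [schoutenContr, hsc, ricciContr_kulkarniNomizu hg hs, ← hτ]
    field_simp
    ring
  rw [weylPart, hA]
  exact sub_self _

/-- The Weyl projection is homogeneous under a simultaneous rescaling. -/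
theorem weylPart_scale {g : Matrix (Fin n) (Fin n) ℝ} (hg : IsUnit g.det) {c : ℝ} (hc : c ≠ 0)
    (R : Fin n → Fin n → Fin n → Fin n → ℝ) (i j k l : Fin n) :
    weylPart (c • g) (fun i j k l => c * R i j k l) i j k l = c * weylPart g R i j k l := by
  have hinv : (c • g)⁻¹ = c⁻¹ • g⁻¹ := by
    let _ := invertibleOfNonzero hc
    rw [Matrix.inv_smul g c hg, invOf_eq_inv]
  have hric : ∀ j k, ricciContr (c • g) (fun i j k l => c * R i j k l) j k
      = ricciContr g R j k := fun j k => by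
    simp only [ricciContr, hinv, Matrix.smul_apply, smul_eq_mul]
    refine Finset.sum_congr rfl fun i _ => Finset.sum_congr rfl fun l _ => ?_
    field_simp
  have hsc : scalarContr (c • g) (fun i j k l => c * R i j k l) = c⁻¹ * scalarContr g R := by
    simp only [scalarContr, hric, hinv, Matrix.smul_apply, smul_eq_mul, mul_assoc,
      ← Finset.mul_sum]
  have hA : schoutenContr (c • g) (fun i j k l => c * R i j k l) = schoutenContr g R := by
    ext i j
    simp only [schoutenContr, hric, hsc, Matrix.smul_apply, smul_eq_mul]
    congr 2
    field_simp
  rw [weylPart, hA, weylPart]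
  simp only [kulkarniNomizu, Matrix.smul_apply, smul_eq_mul]
  ring

/-! ### The conformal change of the curvature: pointwise algebra -/

section ConformalAlgebra

variable (G : Matrix (Fin n) (Fin n) ℝ) (Γ : Fin n → Fin n → Fin n → ℝ)
  (F u : Fin n → ℝ) (FF v : Matrix (Fin n) (Fin n) ℝ) (dG : Fin n → Fin n → Fin n → ℝ)

/-- The difference of the Christoffel symbols of two conformal metrics. -/
def confDiff (m j k : Fin n) : ℝ :=
  (if m = j then F k else 0) + (if m = k then F j else 0) - G j k * u m

/-- The partial derivatives of `confDiff`. -/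
def confDiffDeriv (i m j k : Fin n) : ℝ :=
  (if m = j then FF k i else 0) + (if m = k then FF j i else 0) - dG i j k * u m - G j k * v i m

variable {G Γ F u FF v dG}

theorem sum_confDiff_mul (j k : Fin n) (w : Fin n → ℝ) :
    ∑ m, confDiff G F u m j k * w m = F k * w j + F j * w k - G j k * ∑ m, u m * w m := by
  simp only [confDiff, sub_mul, add_mul, Finset.sum_sub_distrib, Finset.sum_add_distrib, ite_mul,
    zero_mul, Finset.sum_ite_eq', Finset.mem_univ, if_true, mul_assoc, Finset.mul_sum]

theorem sum_confDiffDeriv_mul (i j k : Fin n) (w : Fin n → ℝ) :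
    ∑ m, confDiffDeriv G u FF v dG i m j k * w m
      = FF k i * w j + FF j i * w k - dG i j k * ∑ m, u m * w m - G j k * ∑ m, v i m * w m := by
  simp only [confDiffDeriv, sub_mul, add_mul, Finset.sum_sub_distrib, Finset.sum_add_distrib,
    ite_mul, zero_mul, Finset.sum_ite_eq', Finset.mem_univ, if_true, mul_assoc, Finset.mul_sum]

theorem sum_sum_mul_mul (a : Fin n → ℝ) (b : Fin n → Fin n → ℝ) (w : Fin n → ℝ) :
    ∑ m, (∑ p, a p * b m p) * w m = ∑ p, a p * ∑ m, b m p * w m := by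
  simp only [Finset.sum_mul, Finset.mul_sum]
  rw [Finset.sum_comm]
  simp only [mul_assoc]

/-- The derivatives are free symbols here: `F` stands for `df`, `u` for the gradient of `f`, `FF`
for the second partial derivatives of `f`, and `v`, `dG` for the derivatives of the gradient and of
the metric. The sum collects the terms of one half of the new curvature that involve the difference
of the connections; antisymmetrization in `i, j` comes later. After lowering the index, metric
compatibility removes `dG`, and `v` enters only through its lowered form, so no inverse matrix is
differentiated. -/
theorem conformal_bracket (hs : G.IsSymm)
    (hu : ∀ l, ∑ m, u m * G m l = F l)
    (hdG : ∀ i j k, dG i j k = ∑ p, Γ p i j * G p k + ∑ p, Γ p i k * G p j)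
    (hv : ∀ i l, ∑ m, v i m * G m l = FF l i - ∑ m, dG i m l * u m) (i j k l : Fin n) :
    ∑ m, (confDiffDeriv G u FF v dG i m j k + ∑ p, Γ p j k * confDiff G F u m i p
        + ∑ p, confDiff G F u p j k * Γ m i p
        + ∑ p, confDiff G F u p j k * confDiff G F u m i p) * G m l
      = FF k i * G j l + FF j i * G k l
        - (∑ p, Γ p i j * G p k + ∑ p, Γ p i k * G p j) * F l
        - G j k * (FF l i - ∑ p, Γ p i l * F p)
        + (∑ p, Γ p j k * F p) * G i l + F i * ∑ p, Γ p j k * G p l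
        - (∑ p, Γ p j k * G p i) * F l
        + F k * ∑ p, Γ p i j * G p l + F j * ∑ p, Γ p i k * G p l
        + F k * (F j * G i l + F i * G j l - G i j * F l)
        + F j * (F k * G i l + F i * G k l - G i k * F l)
        - G j k * ((∑ p, u p * F p) * G i l) := by
  have hGs : ∀ a b, G a b = G b a := fun a b => hs.apply b a
  have huF : ∀ i, ∑ p, u p * G i p = F i := fun i => by simp only [hGs i, hu]
  have e0 : ∑ m, dG i m l * u m
      = (∑ m, u m * ∑ p, Γ p i m * G p l) + ∑ p, Γ p i l * F p := by
    simp only [hdG, add_mul, Finset.sum_add_distrib]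
    congr 1
    · exact Finset.sum_congr rfl fun m _ => mul_comm _ _
    · simp only [Finset.sum_mul, ← hu, Finset.mul_sum]
      rw [Finset.sum_comm]
      refine Finset.sum_congr rfl fun m _ => Finset.sum_congr rfl fun p _ => by
        rw [hGs]; ring
  have e1 : ∀ p, ∑ m, confDiff G F u m i p * G m l
      = F p * G i l + F i * G p l - G i p * F l := fun p => by
    rw [sum_confDiff_mul, hu]
  have e2 : ∑ p, Γ p j k * (F p * G i l + F i * G p l - G i p * F l)
      = (∑ p, Γ p j k * F p) * G i l + F i * ∑ p, Γ p j k * G p l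
        - (∑ p, Γ p j k * G p i) * F l := by
    simp only [mul_sub, mul_add, Finset.sum_sub_distrib, Finset.sum_add_distrib, Finset.sum_mul,
      Finset.mul_sum]
    congr 1
    · congr 1
      · exact Finset.sum_congr rfl fun p _ => by ring
      · exact Finset.sum_congr rfl fun p _ => by ring
    · exact Finset.sum_congr rfl fun p _ => by rw [hGs i p]; ring
  have e3 : ∑ p, u p * (F p * G i l + F i * G p l - G i p * F l) = (∑ p, u p * F p) * G i l := by
    have : ∑ p, u p * (F p * G i l + F i * G p l - G i p * F l)
        = (∑ p, u p * F p) * G i l + F i * ∑ p, u p * G p l - (∑ p, u p * G i p) * F l := by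
      simp only [mul_sub, mul_add, Finset.sum_sub_distrib, Finset.sum_add_distrib, Finset.sum_mul,
        Finset.mul_sum]
      congr 1
      · congr 1
        · exact Finset.sum_congr rfl fun p _ => by ring
        · exact Finset.sum_congr rfl fun p _ => by ring
      · exact Finset.sum_congr rfl fun p _ => by ring
    rw [this, hu, huF]; ring
  simp only [add_mul _ _ (G _ l), Finset.sum_add_distrib, sum_sum_mul_mul, e1, sum_confDiffDeriv_mul, hu,
    hv, e0, e2]
  rw [sum_confDiff_mul, sum_confDiff_mul, e3, hdG]
  ring

/-- The conformal change of the Riemann tensor, at a point. -/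
theorem conformal_riemann_algebra (hs : G.IsSymm) (hΓ : ∀ m i j, Γ m i j = Γ m j i)
    (hFF : FF.IsSymm) (hu : ∀ l, ∑ m, u m * G m l = F l)
    (hdG : ∀ i j k, dG i j k = ∑ p, Γ p i j * G p k + ∑ p, Γ p i k * G p j)
    (hv : ∀ i l, ∑ m, v i m * G m l = FF l i - ∑ m, dG i m l * u m)
    (dΓ : Fin n → Fin n → Fin n → Fin n → ℝ) (i j k l : Fin n) :
    ∑ m, ((dΓ i m j k + confDiffDeriv G u FF v dG i m j k)
          - (dΓ j m i k + confDiffDeriv G u FF v dG j m i k)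
          + ∑ p, ((Γ p j k + confDiff G F u p j k) * (Γ m i p + confDiff G F u m i p)
            - (Γ p i k + confDiff G F u p i k) * (Γ m j p + confDiff G F u m j p))) * G m l
      = ∑ m, (dΓ i m j k - dΓ j m i k + ∑ p, (Γ p j k * Γ m i p - Γ p i k * Γ m j p)) * G m l
        - kulkarniNomizu (Matrix.of fun a b => FF a b - ∑ p, Γ p a b * F p - F a * F b
            + 1 / 2 * (∑ p, u p * F p) * G a b) G i j k l := by
  have hGs : ∀ a b, G a b = G b a := fun a b => hs.apply b a
  have hFs : ∀ a b, FF a b = FF b a := fun a b => hFF.apply b a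
  have key : ∀ m, ((dΓ i m j k + confDiffDeriv G u FF v dG i m j k)
          - (dΓ j m i k + confDiffDeriv G u FF v dG j m i k)
          + ∑ p, ((Γ p j k + confDiff G F u p j k) * (Γ m i p + confDiff G F u m i p)
            - (Γ p i k + confDiff G F u p i k) * (Γ m j p + confDiff G F u m j p))) * G m l
      = (dΓ i m j k - dΓ j m i k + ∑ p, (Γ p j k * Γ m i p - Γ p i k * Γ m j p)) * G m l
        + ((confDiffDeriv G u FF v dG i m j k + ∑ p, Γ p j k * confDiff G F u m i p
        + ∑ p, confDiff G F u p j k * Γ m i p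
        + ∑ p, confDiff G F u p j k * confDiff G F u m i p) * G m l
        - (confDiffDeriv G u FF v dG j m i k + ∑ p, Γ p i k * confDiff G F u m j p
        + ∑ p, confDiff G F u p i k * Γ m j p
        + ∑ p, confDiff G F u p i k * confDiff G F u m j p) * G m l) := fun m => by
    simp only [add_mul (_ : ℝ) _ (_ + _), mul_add, Finset.sum_sub_distrib, Finset.sum_add_distrib]
    ring
  simp only [key]
  rw [Finset.sum_add_distrib, Finset.sum_sub_distrib, conformal_bracket hs hu hdG hv,
    conformal_bracket hs hu hdG hv]
  simp only [kulkarniNomizu, Matrix.of_apply]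
  rw [hFs j i, hGs j i, hFs k i, hFs k j, hFs l i, hFs l j]
  simp only [fun p => hΓ p j i, fun p => hΓ p i l, fun p => hΓ p j l]
  simp only [fun p => hΓ p l i, fun p => hΓ p l j]
  ring

end ConformalAlgebra

/-! ### Calculus of partial derivatives -/

section PartialDerivatives

variable {f g : Pt n → ℝ} {x : Pt n}

theorem pd_add (hf : DifferentiableAt ℝ f x) (hg : DifferentiableAt ℝ g x) (i : Fin n) :
    pd i (fun y => f y + g y) x = pd i f x + pd i g x := by
  simp [pd, fderiv_fun_add hf hg]

theorem pd_sub (hf : DifferentiableAt ℝ f x) (hg : DifferentiableAt ℝ g x) (i : Fin n) :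
    pd i (fun y => f y - g y) x = pd i f x - pd i g x := by
  simp [pd, fderiv_fun_sub hf hg]

theorem pd_mul (hf : DifferentiableAt ℝ f x) (hg : DifferentiableAt ℝ g x) (i : Fin n) :
    pd i (fun y => f y * g y) x = pd i f x * g x + f x * pd i g x := by
  simp only [pd, fderiv_fun_mul hf hg, add_apply, smul_apply, smul_eq_mul]
  ring

theorem pd_const (c : ℝ) (i : Fin n) : pd i (fun _ => c) x = 0 := by
  simp [pd]

theorem pd_const_mul (hf : DifferentiableAt ℝ f x) (c : ℝ) (i : Fin n) :
    pd i (fun y => c * f y) x = c * pd i f x := by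
  rw [pd_mul (differentiableAt_const c) hf, pd_const]; ring

theorem pd_mul_const (hf : DifferentiableAt ℝ f x) (c : ℝ) (i : Fin n) :
    pd i (fun y => f y * c) x = pd i f x * c := by
  rw [pd_mul hf (differentiableAt_const c), pd_const]; ring

theorem pd_sum {ι : Type*} {s : Finset ι} {F : ι → Pt n → ℝ}
    (hF : ∀ a ∈ s, DifferentiableAt ℝ (F a) x) (i : Fin n) :
    pd i (fun y => ∑ a ∈ s, F a y) x = ∑ a ∈ s, pd i (F a) x := by
  simp [pd, fderiv_fun_sum hF]

theorem pd_exp (hf : DifferentiableAt ℝ f x) (i : Fin n) :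
    pd i (fun y => Real.exp (f y)) x = Real.exp (f x) * pd i f x := by
  simp [pd, fderiv_exp hf]

theorem pd_congr (h : f =ᶠ[𝓝 x] g) (i : Fin n) : pd i f x = pd i g x := by
  rw [pd, pd, h.fderiv_eq]

theorem contDiff_pd (hf : ContDiff ℝ ∞ f) (i : Fin n) : ContDiff ℝ ∞ (pd i f) :=
  (hf.fderiv_right (m := ∞) (by norm_cast)).clm_apply contDiff_const

theorem diffAt_of_smooth (hf : ContDiff ℝ ∞ f) (x : Pt n) : DifferentiableAt ℝ f x :=
  hf.differentiable (by norm_num) x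

theorem pd_comm (hf : ContDiff ℝ ∞ f) (i j : Fin n) (x : Pt n) :
    pd i (pd j f) x = pd j (pd i f) x := by
  have hd : DifferentiableAt ℝ (fderiv ℝ f) x :=
    (hf.fderiv_right (m := ∞) (by norm_cast)).differentiable (by norm_num) x
  have hsym : IsSymmSndFDerivAt ℝ f x :=
    hf.contDiffAt.isSymmSndFDerivAt (by simp; norm_cast)
  have key : ∀ a b : Fin n, pd a (pd b f) x
      = fderiv ℝ (fderiv ℝ f) x (EuclideanSpace.single a 1) (EuclideanSpace.single b 1) := by
    intro a b
    have : pd b f = fun y => fderiv ℝ f y (EuclideanSpace.single b 1) := rfl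
    rw [this, pd, fderiv_clm_apply hd (differentiableAt_const _)]
    simp
  rw [key, key, hsym]

end PartialDerivatives

/-! ### Differentiability of determinants and inverse matrices -/

section InverseMatrix

variable {E : Type*} [NormedAddCommGroup E] [NormedSpace ℝ E]
  {g : E → Matrix (Fin n) (Fin n) ℝ} {x : E}

theorem differentiableAt_det (hg : ∀ i j, DifferentiableAt ℝ (fun y => g y i j) x) :
    DifferentiableAt ℝ (fun y => (g y).det) x := by
  simp only [Matrix.det_apply]
  refine DifferentiableAt.fun_sum fun σ _ => ?_
  refine DifferentiableAt.const_smul ?_ _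
  exact (HasFDerivAt.finsetProd fun i _ => (hg _ i).hasFDerivAt).differentiableAt

theorem differentiableAt_inv_apply (hg : ∀ i j, DifferentiableAt ℝ (fun y => g y i j) x)
    (hx : IsUnit (g x).det) (m l : Fin n) : DifferentiableAt ℝ (fun y => (g y)⁻¹ m l) x := by
  simp only [Matrix.inv_def, Ring.inverse_eq_inv', Matrix.smul_apply, smul_eq_mul,
    Matrix.adjugate_apply]
  refine DifferentiableAt.mul ((differentiableAt_det hg).inv hx.ne_zero) ?_
  refine differentiableAt_det fun i j => ?_
  by_cases h : i = l
  · subst h; simp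
  · simpa [Matrix.updateRow_apply, h] using hg i j

theorem eventually_isUnit_det (hg : ∀ i j, DifferentiableAt ℝ (fun y => g y i j) x)
    (hx : IsUnit (g x).det) : ∀ᶠ y in 𝓝 x, IsUnit (g y).det := by
  filter_upwards [(differentiableAt_det hg).continuousAt.eventually_ne hx.ne_zero] with y hy
  exact isUnit_iff_ne_zero.2 hy

end InverseMatrix

/-! ### Conformal covariance of the Weyl tensor -/

section Conformal

variable {g : Tensor2 n} {f : Pt n → ℝ}

/-- The gradient of `f` with respect to `g`. -/
def gradUp (g : Tensor2 n) (f : Pt n → ℝ) (m : Fin n) (x : Pt n) : ℝ :=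
  ∑ l, (g x)⁻¹ m l * pd l f x

theorem christoffel_comm (hs : ∀ y, (g y).IsSymm) (x : Pt n) (m i j : Fin n) :
    christoffel g x m i j = christoffel g x m j i := by
  simp only [christoffel]
  congr 1
  refine Finset.sum_congr rfl fun l _ => ?_
  rw [show (fun y => g y j i) = fun y => g y i j from funext fun y => (hs y).apply i j]
  ring

theorem sum_sum_inv_mul {G : Matrix (Fin n) (Fin n) ℝ} (hG : IsUnit G.det) (hs : G.IsSymm)
    (w : Fin n → ℝ) (k : Fin n) : ∑ p, (∑ l, G⁻¹ p l * w l) * G p k = w k := by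
  simp only [Finset.sum_mul]
  rw [Finset.sum_comm]
  have : ∀ l, ∑ p, G⁻¹ p l * w l * G p k = if k = l then w l else 0 := fun l => by
    have : ∀ p, G⁻¹ p l * w l * G p k = w l * (G k p * G⁻¹ p l) := fun p => by
      rw [hs.apply]; ring
    simp only [this, ← Finset.mul_sum, sum_mul_inv hG, mul_ite, mul_one, mul_zero]
  simp [this]

theorem sum_christoffel_mul (hs : ∀ y, (g y).IsSymm) {x : Pt n} (hx : IsUnit (g x).det)
    (i j k : Fin n) :
    ∑ p, christoffel g x p i j * g x p k
      = 1 / 2 * (pd i (fun y => g y j k) x + pd j (fun y => g y i k) x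
          - pd k (fun y => g y i j) x) := by
  simp only [christoffel, mul_assoc (1 / 2 : ℝ), ← Finset.mul_sum]
  rw [sum_sum_inv_mul hx (hs x)]

theorem christoffel_conformal (hg : ∀ i j, ContDiff ℝ ∞ fun y => g y i j)
    (hs : ∀ y, (g y).IsSymm) (hf : ContDiff ℝ ∞ f) {x : Pt n} (hx : IsUnit (g x).det) (m i j : Fin n) :
    christoffel (fun y => Real.exp (2 * f y) • g y) x m i j
      = christoffel g x m i j
        + confDiff (g x) (fun a => pd a f x) (fun a => gradUp g f a x) m i j := by
  have hpd : ∀ a b c, pd a (fun y => (Real.exp (2 * f y) • g y) b c) x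
      = Real.exp (2 * f x) * (pd a (fun y => g y b c) x + 2 * pd a f x * g x b c) := fun a b c => by
    have h2 : DifferentiableAt ℝ (fun y => 2 * f y) x := (diffAt_of_smooth hf x).const_mul 2
    simp only [Matrix.smul_apply, smul_eq_mul]
    rw [pd_mul h2.exp (diffAt_of_smooth (hg b c) x), pd_exp h2, pd_const_mul (diffAt_of_smooth hf x)]
    ring
  have hinv : (Real.exp (2 * f x) • g x)⁻¹ = (Real.exp (2 * f x))⁻¹ • (g x)⁻¹ := by
    let _ := invertibleOfNonzero (Real.exp_pos (2 * f x)).ne'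
    rw [Matrix.inv_smul (g x) _ hx, invOf_eq_inv]
  have key : ∀ l, (Real.exp (2 * f x) • g x)⁻¹ m l *
      (pd i (fun y => (Real.exp (2 * f y) • g y) j l) x
        + pd j (fun y => (Real.exp (2 * f y) • g y) i l) x
        - pd l (fun y => (Real.exp (2 * f y) • g y) i j) x)
      = (g x)⁻¹ m l * (pd i (fun y => g y j l) x + pd j (fun y => g y i l) x
          - pd l (fun y => g y i j) x)
        + (2 * pd i f x * ((g x)⁻¹ m l * g x j l) + 2 * pd j f x * ((g x)⁻¹ m l * g x i l)
        - 2 * g x i j * ((g x)⁻¹ m l * pd l f x)) := fun l => by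
    rw [hpd, hpd, hpd, hinv, Matrix.smul_apply, smul_eq_mul]
    have := (Real.exp_pos (2 * f x)).ne'
    field_simp
    ring
  have hs1 : ∀ a b, ∑ l, (g x)⁻¹ a l * g x b l = if a = b then 1 else 0 := fun a b => by
    simp only [fun l => (hs x).apply l b, sum_inv_mul hx]
  rw [christoffel, christoffel]
  simp only [key]
  rw [Finset.sum_add_distrib, Finset.sum_sub_distrib, Finset.sum_add_distrib, ← Finset.mul_sum,
    ← Finset.mul_sum, ← Finset.mul_sum, hs1, hs1, confDiff, gradUp]
  simp only [mul_ite, mul_one, mul_zero]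
  split_ifs <;> ring

theorem differentiableAt_gradUp (hg : ∀ i j, ContDiff ℝ ∞ fun y => g y i j)
    (hf : ContDiff ℝ ∞ f) {x : Pt n} (hx : IsUnit (g x).det) (m : Fin n) :
    DifferentiableAt ℝ (gradUp g f m) x :=
  DifferentiableAt.fun_sum fun l _ =>
    (differentiableAt_inv_apply (fun i j => diffAt_of_smooth (hg i j) x) hx m l).mul
      (diffAt_of_smooth (contDiff_pd hf l) x)

theorem differentiableAt_christoffel (hg : ∀ i j, ContDiff ℝ ∞ fun y => g y i j)
    {x : Pt n} (hx : IsUnit (g x).det) (m i j : Fin n) :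
    DifferentiableAt ℝ (fun y => christoffel g y m i j) x := by
  have hp : ∀ a b c, DifferentiableAt ℝ (fun y => pd a (fun z => g z b c) y) x := fun a b c =>
    diffAt_of_smooth (contDiff_pd (hg b c) a) x
  refine DifferentiableAt.const_mul (DifferentiableAt.fun_sum fun l _ => ?_) _
  exact (differentiableAt_inv_apply (fun i j => diffAt_of_smooth (hg i j) x) hx m l).mul
    (((hp _ _ _).add (hp _ _ _)).sub (hp _ _ _))

theorem pd_confDiff (hg : ∀ i j, ContDiff ℝ ∞ fun y => g y i j)
    (hf : ContDiff ℝ ∞ f) {x : Pt n} (hx : IsUnit (g x).det) (i m j k : Fin n) :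
    pd i (fun y => confDiff (g y) (fun a => pd a f y) (fun a => gradUp g f a y) m j k) x
      = confDiffDeriv (g x) (fun a => gradUp g f a x) (Matrix.of fun a b => pd a (pd b f) x)
          (Matrix.of fun a b => pd a (gradUp g f b) x)
          (fun a b c => pd a (fun y => g y b c) x) i m j k := by
  have hp : ∀ a b : Fin n, DifferentiableAt ℝ (fun y => if m = a then pd b f y else 0) x :=
    fun a b => by
      by_cases h : m = a
      · simpa [h] using diffAt_of_smooth (contDiff_pd hf b) x
      · simp [h]
  have hq : ∀ a b : Fin n, pd i (fun y => if m = a then pd b f y else 0) x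
      = if m = a then pd b (pd i f) x else 0 := fun a b => by
    by_cases h : m = a
    · simp only [h, if_true]
      exact pd_comm hf i b x
    · simp [h, pd_const]
  have hgr := differentiableAt_gradUp hg hf hx m
  have hgd := diffAt_of_smooth (hg j k) x
  simp only [confDiff, confDiffDeriv, Matrix.of_apply]
  rw [pd_sub ((hp _ _).fun_add (hp _ _)) (hgd.fun_mul hgr), pd_add (hp _ _) (hp _ _), hq, hq,
    pd_mul hgd hgr]
  ring

/-- The Hessian-type tensor in the conformal change of the Riemann tensor. -/
def confHess (g : Tensor2 n) (f : Pt n → ℝ) (x : Pt n) : Matrix (Fin n) (Fin n) ℝ :=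
  Matrix.of fun a b => pd a (pd b f) x - ∑ p, christoffel g x p a b * pd p f x
    - pd a f x * pd b f x + 1 / 2 * (∑ p, gradUp g f p x * pd p f x) * g x a b

/-- The pointwise identity `conformal_riemann_algebra` does the work; the proof checks its
hypotheses for the actual derivatives. Since the correction is a Kulkarni-Nomizu product with `g`,
the Weyl projection does not see it. -/
theorem riemann_conformal (hg : ∀ i j, ContDiff ℝ ∞ fun y => g y i j)
    (hs : ∀ y, (g y).IsSymm) (hf : ContDiff ℝ ∞ f) {x : Pt n} (hx : IsUnit (g x).det)
    (i j k l : Fin n) :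
    riemann (fun y => Real.exp (2 * f y) • g y) x i j k l
      = Real.exp (2 * f x) * (riemann g x i j k l
          - kulkarniNomizu (confHess g f x) (g x) i j k l) := by
  have hgd : ∀ i j, DifferentiableAt ℝ (fun y => g y i j) x := fun i j =>
    diffAt_of_smooth (hg i j) x
  have hev := eventually_isUnit_det hgd hx
  have hpd : ∀ a m b c, pd a (fun y => christoffel (fun y => Real.exp (2 * f y) • g y) y m b c) x
      = pd a (fun y => christoffel g y m b c) x
        + confDiffDeriv (g x) (fun a => gradUp g f a x) (Matrix.of fun a b => pd a (pd b f) x)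
          (Matrix.of fun a b => pd a (gradUp g f b) x)
          (fun a b c => pd a (fun y => g y b c) x) a m b c := fun a m b c => by
    have h1 : (fun y => christoffel (fun y => Real.exp (2 * f y) • g y) y m b c) =ᶠ[𝓝 x]
        fun y => christoffel g y m b c
          + confDiff (g y) (fun a => pd a f y) (fun a => gradUp g f a y) m b c := by
      filter_upwards [hev] with y hy
      exact christoffel_conformal hg hs hf hy m b c
    have hgr := differentiableAt_gradUp hg hf hx m
    have hp : ∀ a b : Fin n, DifferentiableAt ℝ (fun y => if m = a then pd b f y else 0) x :=
      fun a b => by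
        by_cases h : m = a
        · simpa [h] using diffAt_of_smooth (contDiff_pd hf b) x
        · simp [h]
    rw [pd_congr h1, pd_add (differentiableAt_christoffel hg hx m b c), pd_confDiff hg hf hx]
    exact ((hp _ _).fun_add (hp _ _)).fun_sub ((hgd _ _).mul hgr)
  have hu : ∀ y, IsUnit (g y).det → ∀ l, ∑ m, gradUp g f m y * g y m l = pd l f y :=
    fun y hy l => sum_sum_inv_mul hy (hs y) _ l
  have hdG : ∀ a b c, pd a (fun y => g y b c) x
      = ∑ p, christoffel g x p a b * g x p c + ∑ p, christoffel g x p a c * g x p b :=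
    fun a b c => by
      have hc : ∀ a b c, pd a (fun y => g y b c) x = pd a (fun y => g y c b) x := fun a b c => by
        rw [show (fun y => g y b c) = fun y => g y c b from funext fun y => (hs y).apply c b]
      rw [sum_christoffel_mul hs hx, sum_christoffel_mul hs hx, hc a c b, hc b a c]
      ring
  -- The gradient is differentiated implicitly, through its defining relation with `df`.
  have hv : ∀ a l, ∑ m, pd a (gradUp g f m) x * g x m l
      = pd l (pd a f) x - ∑ m, pd a (fun y => g y m l) x * gradUp g f m x := fun a l => by
    have h1 : (fun y => ∑ m, gradUp g f m y * g y m l) =ᶠ[𝓝 x] pd l f := by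
      filter_upwards [hev] with y hy
      exact hu y hy l
    have h2 := pd_congr h1 a
    rw [pd_sum fun m _ => (differentiableAt_gradUp hg hf hx m).fun_mul (hgd m l)] at h2
    simp only [fun m => pd_mul (differentiableAt_gradUp hg hf hx m) (hgd m l) a,
      Finset.sum_add_distrib] at h2
    rw [pd_comm hf l a, ← h2]
    simp only [mul_comm (gradUp g f _ x)]
    ring
  have key := conformal_riemann_algebra (G := g x) (Γ := christoffel g x)
    (F := fun a => pd a f x) (u := fun a => gradUp g f a x)
    (FF := Matrix.of fun a b => pd a (pd b f) x)
    (v := Matrix.of fun a b => pd a (gradUp g f b) x)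
    (dG := fun a b c => pd a (fun y => g y b c) x) (hs x) (christoffel_comm hs x)
    (Matrix.IsSymm.ext fun a b => pd_comm hf b a x) (hu x hx) hdG hv
    (fun a m b c => pd a (fun y => christoffel g y m b c) x) i j k l
  simp only [riemann, riemannUp, hpd, christoffel_conformal hg hs hf hx, Matrix.smul_apply,
    smul_eq_mul, mul_left_comm _ (Real.exp (2 * f x)), ← Finset.mul_sum]
  congr 1

/-- **Conformal covariance of the Weyl tensor.** -/
theorem weyl_conformal (hn : 3 ≤ n) (hg : ∀ i j, ContDiff ℝ ∞ fun y => g y i j)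
    (hs : ∀ y, (g y).IsSymm) (hf : ContDiff ℝ ∞ f) {x : Pt n} (hx : IsUnit (g x).det)
    (i j k l : Fin n) :
    weyl (fun y => Real.exp (2 * f y) • g y) x i j k l
      = Real.exp (2 * f x) * weyl g x i j k l := by
  have h1 : riemann (fun y => Real.exp (2 * f y) • g y) x = fun i j k l =>
      Real.exp (2 * f x) * (riemann g x i j k l
          + -1 * kulkarniNomizu (confHess g f x) (g x) i j k l) := by
    ext i j k l
    rw [riemann_conformal hg hs hf hx]
    ring
  rw [weyl_eq_weylPart, weyl_eq_weylPart, h1, weylPart_scale hx (Real.exp_pos _).ne',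
    weylPart_add, weylPart_smul, weylPart_kulkarniNomizu hn hx (hs x)]
  ring

end Conformal

/-! ### The linearization of the Weyl tensor at the Euclidean metric -/

/-- The linearization of the Riemann tensor at the Euclidean metric. -/
def linRiemann (T : Tensor2 n) (x : Pt n) (i j k l : Fin n) : ℝ :=
  1 / 2 * (pd i (pd k fun y => T y j l) x + pd j (pd l fun y => T y i k) x
    - pd i (pd l fun y => T y j k) x - pd j (pd k fun y => T y i l) x)

/-- The linearization of the Weyl tensor at the Euclidean metric. -/
def flatWeyl (T : Tensor2 n) (x : Pt n) : Fin n → Fin n → Fin n → Fin n → ℝ :=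
  weylPart 1 (linRiemann T x)

/-- Once a factor `t` is split off, differentiation at `0` needs only continuity of the remaining
factor. This spares every derivative in `t` of inverse metrics and curvature contractions. -/
theorem hasDerivAt_mul_of_continuousAt {b : ℝ → ℝ} (hb : ContinuousAt b 0) :
    HasDerivAt (fun t => t * b t) (b 0) 0 := by
  rw [hasDerivAt_iff_tendsto_slope_zero]
  refine (hb.tendsto.mono_left nhdsWithin_le_nhds).congr' ?_
  filter_upwards [self_mem_nhdsWithin] with t ht
  simp [inv_mul_cancel_left₀ (show t ≠ 0 from ht)]

theorem continuousAt_weylPart {X : Type*} [TopologicalSpace X] {t₀ : X}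
    {g : X → Matrix (Fin n) (Fin n) ℝ} {R : X → Fin n → Fin n → Fin n → Fin n → ℝ}
    (hg : ∀ i j, ContinuousAt (fun t => g t i j) t₀)
    (hi : ∀ i j, ContinuousAt (fun t => (g t)⁻¹ i j) t₀)
    (hR : ∀ i j k l, ContinuousAt (fun t => R t i j k l) t₀) (i j k l : Fin n) :
    ContinuousAt (fun t => weylPart (g t) (R t) i j k l) t₀ := by
  have h1 : ∀ j k, ContinuousAt (fun t => ricciContr (g t) (R t) j k) t₀ := fun j k =>
    tendsto_finsetSum _ fun i _ => tendsto_finsetSum _ fun l _ => (hi i l).mul (hR i j k l)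
  have h2 : ContinuousAt (fun t => scalarContr (g t) (R t)) t₀ :=
    tendsto_finsetSum _ fun i _ => tendsto_finsetSum _ fun l _ => (hi i l).mul (h1 i l)
  have h3 : ∀ j k, ContinuousAt (fun t => schoutenContr (g t) (R t) j k) t₀ := fun j k =>
    continuousAt_const.mul ((h1 j k).sub ((continuousAt_const.mul h2).mul (hg j k)))
  exact (hR i j k l).sub (((((h3 i l).mul (hg j k)).add ((h3 j k).mul (hg i l))).sub
    ((h3 i k).mul (hg j l))).sub ((h3 j l).mul (hg i k)))

theorem pd_inv_apply {g : Tensor2 n} (hg : ∀ i j, ContDiff ℝ ∞ fun y => g y i j) {x : Pt n}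
    (hx : IsUnit (g x).det) (a m l : Fin n) :
    pd a (fun y => (g y)⁻¹ m l) x
      = -∑ k, (∑ p, (g x)⁻¹ m p * pd a (fun y => g y p k) x) * (g x)⁻¹ k l := by
  have hgd : ∀ i j, DifferentiableAt ℝ (fun y => g y i j) x := fun i j =>
    diffAt_of_smooth (hg i j) x
  have hid : ∀ i j, DifferentiableAt ℝ (fun y => (g y)⁻¹ i j) x :=
    differentiableAt_inv_apply hgd hx
  have h1 : ∀ k, ∑ p, (g x)⁻¹ m p * pd a (fun y => g y p k) x
      = -∑ p, pd a (fun y => (g y)⁻¹ m p) x * g x p k := fun k => by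
    have h2 : (fun y => ∑ p, (g y)⁻¹ m p * g y p k) =ᶠ[𝓝 x] fun _ => if m = k then 1 else 0 := by
      filter_upwards [eventually_isUnit_det hgd hx] with y hy
      exact sum_inv_mul hy m k
    have h3 := pd_congr h2 a
    rw [pd_const, pd_sum fun p _ => (hid m p).fun_mul (hgd p k)] at h3
    simp only [fun p => pd_mul (hid m p) (hgd p k) a, Finset.sum_add_distrib] at h3
    linarith
  simp only [h1, neg_mul, Finset.sum_neg_distrib, neg_neg, Finset.sum_mul]
  rw [Finset.sum_comm]
  simp only [mul_assoc, ← Finset.mul_sum, sum_mul_inv hx, mul_ite, mul_one, mul_zero]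
  simp

/-! ### First-order expansion of the Weyl tensor along `1 + t T` -/

section Linearization

variable {T : Tensor2 n}

/-- Twice the linearization of the Christoffel symbols (of the first kind). -/
def linChristoffel (T : Tensor2 n) (j k l : Fin n) (y : Pt n) : ℝ :=
  pd j (fun z => T z k l) y + pd k (fun z => T z j l) y - pd l (fun z => T z j k) y

/-- The affine family of metrics through the Euclidean metric. -/
def affineMetric (T : Tensor2 n) (t : ℝ) : Tensor2 n := fun y => 1 + t • T y

theorem affineMetric_smooth (hT : ∀ i j, ContDiff ℝ ∞ fun y => T y i j) (t : ℝ) (i j : Fin n) :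
    ContDiff ℝ ∞ fun y => affineMetric T t y i j := by
  simp only [affineMetric, Matrix.add_apply, Matrix.smul_apply, smul_eq_mul]
  exact contDiff_const.add (contDiff_const.mul (hT i j))

theorem pd_affineMetric (hT : ∀ i j, ContDiff ℝ ∞ fun y => T y i j) (t : ℝ) (a i j : Fin n)
    (x : Pt n) : pd a (fun y => affineMetric T t y i j) x = t * pd a (fun y => T y i j) x := by
  simp only [affineMetric, Matrix.add_apply, Matrix.smul_apply, smul_eq_mul]
  have h := diffAt_of_smooth (hT i j) x
  rw [pd_add (differentiableAt_const _) (h.const_mul t), pd_const, pd_const_mul h, zero_add]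

theorem christoffel_affineMetric (hT : ∀ i j, ContDiff ℝ ∞ fun y => T y i j) (t : ℝ) (x : Pt n)
    (m j k : Fin n) :
    christoffel (affineMetric T t) x m j k
      = t * (1 / 2 * ∑ l, (affineMetric T t x)⁻¹ m l * linChristoffel T j k l x) := by
  simp only [christoffel, pd_affineMetric hT, linChristoffel, Finset.mul_sum]
  exact Finset.sum_congr rfl fun l _ => by ring

theorem smooth_linChristoffel (hT : ∀ i j, ContDiff ℝ ∞ fun y => T y i j) (j k l : Fin n) :
    ContDiff ℝ ∞ (linChristoffel T j k l) :=
  ((contDiff_pd (hT _ _) _).add (contDiff_pd (hT _ _) _)).sub (contDiff_pd (hT _ _) _)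

/-- The Euclidean metric has constant components, so the Christoffel symbols of `1 + t T`, their
derivatives and hence the Riemann tensor carry a factor `t`. Thus the Weyl tensor is `t` times the
Weyl projection of some `R t` continuous at `0`, and the derivative is the value of that projection
at `t = 0`. -/
theorem hasDerivAt_weyl_affineMetric (hT : ∀ i j, ContDiff ℝ ∞ fun y => T y i j)
    (x : Pt n) (i j k l : Fin n) :
    HasDerivAt (fun t => weyl (affineMetric T t) x i j k l) (flatWeyl T x i j k l) 0 := by
  have hgd : ∀ i j, DifferentiableAt ℝ (fun t => affineMetric T t x i j) 0 := fun i j => by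
    simp only [affineMetric, Matrix.add_apply, Matrix.smul_apply, smul_eq_mul]
    fun_prop
  have h0 : affineMetric T 0 x = 1 := by simp [affineMetric]
  have hu : IsUnit (affineMetric T 0 x).det := by rw [h0]; simp
  have hev := eventually_isUnit_det hgd hu
  have hgc : ∀ i j, ContinuousAt (fun t => affineMetric T t x i j) 0 :=
    fun i j => (hgd i j).continuousAt
  have hic : ∀ i j, ContinuousAt (fun t => (affineMetric T t x)⁻¹ i j) 0 :=
    fun i j => (differentiableAt_inv_apply hgd hu i j).continuousAt
  let b : ℝ → Fin n → Fin n → Fin n → ℝ := fun t m j k =>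
    1 / 2 * ∑ l, (affineMetric T t x)⁻¹ m l * linChristoffel T j k l x
  have hb : ∀ m j k, ContinuousAt (fun t => b t m j k) 0 := fun m j k =>
    continuousAt_const.mul (tendsto_finsetSum _ fun l _ => (hic m l).mul continuousAt_const)
  let di : ℝ → Fin n → Fin n → Fin n → ℝ := fun t a m l =>
    -(t * ∑ k, (∑ p, (affineMetric T t x)⁻¹ m p * pd a (fun y => T y p k) x)
      * (affineMetric T t x)⁻¹ k l)
  have hdi : ∀ a m l, ContinuousAt (fun t => di t a m l) 0 := fun a m l =>
    (continuousAt_id.mul (tendsto_finsetSum _ fun k _ => (tendsto_finsetSum _ fun p _ =>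
      (hic m p).mul continuousAt_const).mul (hic k l))).neg
  let db : ℝ → Fin n → Fin n → Fin n → Fin n → ℝ := fun t a m j k =>
    1 / 2 * ∑ l, (di t a m l * linChristoffel T j k l x
      + (affineMetric T t x)⁻¹ m l * pd a (linChristoffel T j k l) x)
  have hdb : ∀ a m j k, ContinuousAt (fun t => db t a m j k) 0 := fun a m j k =>
    continuousAt_const.mul (tendsto_finsetSum _ fun l _ =>
      ((hdi a m l).mul continuousAt_const).add ((hic m l).mul continuousAt_const))
  let r : ℝ → Fin n → Fin n → Fin n → Fin n → ℝ := fun t i j k m =>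
    db t i m j k - db t j m i k + t * ∑ p, (b t p j k * b t m i p - b t p i k * b t m j p)
  have hr : ∀ i j k m, ContinuousAt (fun t => r t i j k m) 0 := fun i j k m =>
    ((hdb _ _ _ _).sub (hdb _ _ _ _)).add (continuousAt_id.mul (tendsto_finsetSum _ fun p _ =>
      ((hb _ _ _).mul (hb _ _ _)).sub ((hb _ _ _).mul (hb _ _ _))))
  let R : ℝ → Fin n → Fin n → Fin n → Fin n → ℝ := fun t i j k l =>
    ∑ m, r t i j k m * affineMetric T t x m l
  have hR : ∀ i j k l, ContinuousAt (fun t => R t i j k l) 0 := fun i j k l =>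
    tendsto_finsetSum _ fun m _ => (hr _ _ _ _).mul (hgc _ _)
  have hpdb : ∀ t, IsUnit (affineMetric T t x).det → ∀ a m j k,
      pd a (fun y => christoffel (affineMetric T t) y m j k) x = t * db t a m j k := by
    intro t ht a m j k
    have hsm := affineMetric_smooth hT t
    have hid : ∀ m l, DifferentiableAt ℝ (fun y => (affineMetric T t y)⁻¹ m l) x :=
      differentiableAt_inv_apply (fun i j => diffAt_of_smooth (hsm i j) x) ht
    have hcd : ∀ l, DifferentiableAt ℝ (linChristoffel T j k l) x := fun l =>
      diffAt_of_smooth (smooth_linChristoffel hT j k l) x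
    have hpi : ∀ l, pd a (fun y => (affineMetric T t y)⁻¹ m l) x = di t a m l := fun l => by
      rw [pd_inv_apply hsm ht]
      simp only [pd_affineMetric hT, di, Finset.mul_sum, Finset.sum_mul]
      congr 1
      refine Finset.sum_congr rfl fun p _ => Finset.sum_congr rfl fun q _ => by ring
    have hsd : DifferentiableAt ℝ
        (fun y => ∑ l, (affineMetric T t y)⁻¹ m l * linChristoffel T j k l y) x :=
      DifferentiableAt.fun_sum fun l _ => (hid m l).fun_mul (hcd l)
    simp only [christoffel_affineMetric hT]
    rw [pd_const_mul (hsd.const_mul _), pd_const_mul hsd,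
      pd_sum fun l _ => (hid m l).fun_mul (hcd l)]
    simp only [fun l => pd_mul (hid m l) (hcd l) a, hpi, db]
  have hriem : ∀ t, IsUnit (affineMetric T t x).det →
      riemann (affineMetric T t) x = fun i j k l => t * R t i j k l := by
    intro t ht
    ext i j k l
    simp only [riemann, riemannUp, hpdb t ht]
    simp only [christoffel_affineMetric hT]
    change _ = t * ∑ m, r t i j k m * affineMetric T t x m l
    rw [Finset.mul_sum]
    refine Finset.sum_congr rfl fun m _ => ?_
    have : ∀ A B C D E : ℝ, C = t * D → (t * A - t * B + C) * E = t * ((A - B + D) * E) := by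
      intro A B C D E h
      rw [h]; ring
    refine this _ _ _ _ _ ?_
    simp only [Finset.mul_sum _ _ t]
    exact Finset.sum_congr rfl fun p _ => by simp only [b]; ring
  -- At `t = 0` the inverse metric is the identity, and both its derivative `di` and the quadratic
  -- Christoffel term still carry a factor `t`.
  have hR0 : R 0 = linRiemann T x := by
    ext i j k l
    have hp : ∀ a b c, DifferentiableAt ℝ (fun y => pd a (fun z => T z b c) y) x := fun a b c =>
      diffAt_of_smooth (contDiff_pd (hT b c) a) x
    have hlc : ∀ a j k l, pd a (linChristoffel T j k l) x
        = pd a (pd j fun z => T z k l) x + pd a (pd k fun z => T z j l) x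
          - pd a (pd l fun z => T z j k) x := fun a j k l => by
      change pd a (fun y => pd j (fun z => T z k l) y + pd k (fun z => T z j l) y
        - pd l (fun z => T z j k) y) x = _
      rw [pd_sub ((hp _ _ _).fun_add (hp _ _ _)) (hp _ _ _), pd_add (hp _ _ _) (hp _ _ _)]
    simp only [R, r, db, di, h0, inv_one, Matrix.one_apply, zero_mul, neg_zero, zero_add,
      ite_mul, one_mul, mul_ite, mul_one, mul_zero, Finset.sum_ite_eq, Finset.sum_ite_eq',
      Finset.mem_univ, if_true, add_zero, hlc, linRiemann]
    rw [pd_comm (hT k l) j i]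
    ring
  have hW : (fun t => weyl (affineMetric T t) x i j k l) =ᶠ[𝓝 0]
      fun t => t * weylPart (affineMetric T t x) (R t) i j k l := by
    filter_upwards [hev] with t ht
    rw [weyl_eq_weylPart, hriem t ht, weylPart_smul]
  have : HasDerivAt (fun t => weyl (affineMetric T t) x i j k l)
      (weylPart (affineMetric T 0 x) (R 0) i j k l) 0 := (hasDerivAt_mul_of_continuousAt
    (continuousAt_weylPart hgc hic hR i j k l)).congr_of_eventuallyEq hW
  rw [h0, hR0] at this
  exact this

end Linearization

/-! ### The linearized Weyl tensor at a conformally flat metric -/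

/-- The path is `φ (1 + t T)`, whose conformal factor does not depend on `t`; conformal covariance
therefore applies for each small `t` and commutes with the derivative. Smallness of `t` keeps `1 + t
T` invertible at `x`. -/
theorem linWeyl_conformallyFlat (hn : 3 ≤ n) {T : Tensor2 n}
    (hT : ∀ i j, ContDiff ℝ ∞ fun y => T y i j) (hs : ∀ y, (T y).IsSymm) {φ : Pt n → ℝ}
    (hφ : ContDiff ℝ ∞ φ) (hpos : ∀ y, 0 < φ y) (x : Pt n) (i j k l : Fin n) :
    linWeyl (fun y => φ y • 1) (fun y => φ y • T y) x i j k l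
      = φ x * flatWeyl T x i j k l := by
  have hgd : ∀ i j, DifferentiableAt ℝ (fun t => affineMetric T t x i j) 0 := fun i j => by
    simp only [affineMetric, Matrix.add_apply, Matrix.smul_apply, smul_eq_mul]
    fun_prop
  have hu : IsUnit (affineMetric T 0 x).det := by simp [affineMetric]
  have hf : ContDiff ℝ ∞ fun y => 1 / 2 * Real.log (φ y) :=
    contDiff_const.mul (hφ.log fun y => (hpos y).ne')
  have hexp : ∀ y, Real.exp (2 * (1 / 2 * Real.log (φ y))) = φ y := fun y => by
    rw [← mul_assoc]; norm_num [Real.exp_log (hpos y)]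
  have hev : (fun t : ℝ => weyl (fun y => φ y • (1 : Matrix (Fin n) (Fin n) ℝ) + t • φ y • T y)
      x i j k l) =ᶠ[𝓝 0] fun t => φ x * weyl (affineMetric T t) x i j k l := by
    filter_upwards [eventually_isUnit_det hgd hu] with t ht
    have h1 := weyl_conformal hn (affineMetric_smooth hT t)
      (fun y => Matrix.isSymm_one.add ((hs y).smul t)) hf ht i j k l
    simp only [hexp] at h1
    rw [← h1]
    congr 1
    ext1 y
    rw [affineMetric, smul_add, smul_comm]
  rw [linWeyl, hev.deriv_eq]
  exact ((hasDerivAt_weyl_affineMetric hT x i j k l).const_mul _).deriv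

/-! ### Properties of the flat linearization -/

theorem pd_pd_add {f g : Pt n → ℝ} (hf : ContDiff ℝ ∞ f) (hg : ContDiff ℝ ∞ g) (i j : Fin n)
    (x : Pt n) :
    pd i (pd j fun y => f y + g y) x = pd i (pd j f) x + pd i (pd j g) x := by
  have : (pd j fun y => f y + g y) = fun y => pd j f y + pd j g y := funext fun y =>
    pd_add (diffAt_of_smooth hf y) (diffAt_of_smooth hg y) j
  rw [this, pd_add (diffAt_of_smooth (contDiff_pd hf j) x) (diffAt_of_smooth (contDiff_pd hg j) x)]

theorem pd_pd_mul_const {f : Pt n → ℝ} (hf : ContDiff ℝ ∞ f) (c : ℝ) (i j : Fin n) (x : Pt n) :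
    pd i (pd j fun y => f y * c) x = pd i (pd j f) x * c := by
  have : (pd j fun y => f y * c) = fun y => pd j f y * c := funext fun y =>
    pd_mul_const (diffAt_of_smooth hf y) c j
  rw [this, pd_mul_const (diffAt_of_smooth (contDiff_pd hf j) x)]

theorem pd_pd_congr {f g : Pt n → ℝ} {x : Pt n} (h : f =ᶠ[𝓝 x] g) (i j : Fin n) :
    pd i (pd j f) x = pd i (pd j g) x := by
  refine pd_congr ?_ i
  filter_upwards [h.eventuallyEq_nhds] with y hy
  exact pd_congr hy j

theorem flatWeyl_add {T S : Tensor2 n} (hT : ∀ i j, ContDiff ℝ ∞ fun y => T y i j)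
    (hS : ∀ i j, ContDiff ℝ ∞ fun y => S y i j) (x : Pt n) (i j k l : Fin n) :
    flatWeyl (fun y => T y + S y) x i j k l = flatWeyl T x i j k l + flatWeyl S x i j k l := by
  have : linRiemann (fun y => T y + S y) x
      = fun i j k l => linRiemann T x i j k l + linRiemann S x i j k l := by
    ext i j k l
    simp only [linRiemann, Matrix.add_apply, pd_pd_add (hT _ _) (hS _ _)]
    ring
  rw [flatWeyl, this, weylPart_add, flatWeyl, flatWeyl]

theorem flatWeyl_congr {T S : Tensor2 n} {x : Pt n} (h : T =ᶠ[𝓝 x] S) :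
    flatWeyl T x = flatWeyl S x := by
  have h1 : ∀ a b, (fun y => T y a b) =ᶠ[𝓝 x] fun y => S y a b := fun a b =>
    h.mono fun y hy => by simp only [hy]
  have : linRiemann T x = linRiemann S x := by
    ext i j k l
    simp only [linRiemann, pd_pd_congr (h1 _ _)]
  rw [flatWeyl, this, flatWeyl]

theorem smooth_linRiemann {T : Tensor2 n} (hT : ∀ i j, ContDiff ℝ ∞ fun y => T y i j)
    (i j k l : Fin n) : ContDiff ℝ ∞ fun x => linRiemann T x i j k l := by
  have := fun a b c d => contDiff_pd (contDiff_pd (hT a b) c) d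
  exact contDiff_const.mul ((((this _ _ _ _).add (this _ _ _ _)).sub (this _ _ _ _)).sub
    (this _ _ _ _))

theorem continuous_flatWeyl {T : Tensor2 n} (hT : ∀ i j, ContDiff ℝ ∞ fun y => T y i j)
    (i j k l : Fin n) : Continuous fun x => flatWeyl T x i j k l :=
  continuous_iff_continuousAt.2 fun _ => continuousAt_weylPart (g := fun _ => 1)
    (fun _ _ => continuousAt_const) (fun _ _ => continuousAt_const)
    (fun i j k l => (smooth_linRiemann hT i j k l).continuous.continuousAt) i j k l

/-! ### Invariance under the conformal Killing operator -/

section ConformalKilling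

variable {X : Pt n → Pt n}

theorem smooth_component (hX : ContDiff ℝ ∞ X) (i : Fin n) : ContDiff ℝ ∞ fun y => X y i :=
  (contDiff_piLp 2).1 hX i

theorem smooth_divVec (hX : ContDiff ℝ ∞ X) : ContDiff ℝ ∞ (divVec X) :=
  ContDiff.sum fun i _ => contDiff_pd (smooth_component hX i) i

theorem smooth_conformalKilling (hX : ContDiff ℝ ∞ X) (i j : Fin n) :
    ContDiff ℝ ∞ fun y => conformalKilling X y i j :=
  ((contDiff_pd (smooth_component hX j) i).add (contDiff_pd (smooth_component hX i) j)).sub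
    ((contDiff_const.mul (smooth_divVec hX)).mul contDiff_const)

theorem conformalKilling_isSymm (X : Pt n → Pt n) (x : Pt n) : (conformalKilling X x).IsSymm := by
  refine Matrix.IsSymm.ext fun i j => ?_
  simp only [conformalKilling, Matrix.of_apply, (Matrix.isSymm_one (n := Fin n) (α := ℝ)).apply i j]
  ring

/-- The linearized Weyl tensor vanishes on the image of the conformal Killing operator. -/
theorem flatWeyl_conformalKilling (hn : 3 ≤ n) (hX : ContDiff ℝ ∞ X) (x : Pt n)
    (i j k l : Fin n) : flatWeyl (conformalKilling X) x i j k l = 0 := by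
  have hc := smooth_component hX
  have hψ := smooth_divVec hX
  have h1 : ∀ a b c d, pd a (pd b fun y => conformalKilling X y c d) x
      = pd a (pd b (pd c fun y => X y d)) x + pd a (pd b (pd d fun y => X y c)) x
        + pd a (pd b (divVec X)) x * (-(2 / (n : ℝ)) * (1 : Matrix (Fin n) (Fin n) ℝ) c d) := by
    intro a b c d
    have : (fun y => conformalKilling X y c d) = fun y => (pd c (fun y => X y d) y
        + pd d (fun y => X y c) y)
        + divVec X y * (-(2 / (n : ℝ)) * (1 : Matrix (Fin n) (Fin n) ℝ) c d) := by
      ext y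
      simp only [conformalKilling, Matrix.of_apply]
      ring
    rw [this, pd_pd_add ((contDiff_pd (hc d) c).add (contDiff_pd (hc c) d))
      (hψ.mul contDiff_const), pd_pd_mul_const hψ,
      pd_pd_add (contDiff_pd (hc d) c) (contDiff_pd (hc c) d)]
  have h2 : ∀ a b c d, pd a (pd b (pd c fun y => X y d)) x
      = pd a (pd c (pd b fun y => X y d)) x := fun a b c d => by
    congr 1
    exact funext fun y => pd_comm (hc d) b c y
  have h2' : ∀ a b c d, pd a (pd b (pd c fun y => X y d)) x
      = pd c (pd b (pd a fun y => X y d)) x := fun a b c d => by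
    rw [pd_comm (contDiff_pd (hc d) c) a b, h2 b a c, pd_comm (contDiff_pd (hc d) a) b c]
  -- The third derivatives of the components of `X` cancel by symmetry of partial derivatives, which
  -- is the infinitesimal diffeomorphism invariance of flatness. What survives is the Hessian of
  -- `div X` multiplied by the metric, and the Weyl projection kills it.
  have h3 : linRiemann (conformalKilling X) x = kulkarniNomizu
      (Matrix.of fun a b => (1 / (n : ℝ)) * pd a (pd b (divVec X)) x) 1 := by
    ext i j k l
    simp only [linRiemann, h1, kulkarniNomizu, Matrix.of_apply]
    rw [h2' i k j l, h2 i k l j, h2' j l i k, h2 j l k i]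
    ring
  rw [flatWeyl, h3, weylPart_kulkarniNomizu hn (by simp) Matrix.isSymm_one]

end ConformalKilling

/-! ### The integrand -/

/-- The squared Euclidean norm of the linearized Weyl tensor. -/
def flatWeylSq (T : Tensor2 n) (x : Pt n) : ℝ :=
  ∑ i, ∑ j, ∑ k, ∑ l, flatWeyl T x i j k l ^ 2

theorem normSq4_smul_one {g : Tensor2 n} {x : Pt n} {c : ℝ} (hc : c ≠ 0) (hg : g x = c • 1)
    (A : Fin n → Fin n → Fin n → Fin n → ℝ) :
    normSq4 g x A = (c⁻¹) ^ 4 * ∑ i, ∑ j, ∑ k, ∑ l, A i j k l ^ 2 := by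
  have hinv : (g x)⁻¹ = c⁻¹ • (1 : Matrix (Fin n) (Fin n) ℝ) := by
    let _ := invertibleOfNonzero hc
    rw [hg, Matrix.inv_smul 1 c (by simp), invOf_eq_inv, inv_one]
  simp only [normSq4, hinv, Matrix.smul_apply, Matrix.one_apply, smul_eq_mul, mul_ite, mul_one,
    mul_zero, ite_mul, zero_mul, Finset.sum_ite_eq, Finset.mem_univ, if_true, Finset.mul_sum]
  refine Finset.sum_congr rfl fun i _ => Finset.sum_congr rfl fun j _ =>
    Finset.sum_congr rfl fun k _ => Finset.sum_congr rfl fun l _ => ?_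
  ring

theorem bubble_rpow (hn : 5 ≤ n) {ε : ℝ} (hε : 0 < ε) (x : Pt n) :
    bubble ε x ^ (4 / ((n : ℝ) - 4)) = (ε / (ε ^ 2 + ‖x‖ ^ 2)) ^ 2 := by
  have h5 : (5 : ℝ) ≤ n := by exact_mod_cast hn
  have h4 : (n : ℝ) - 4 ≠ 0 := by linarith
  have h2 : ((n : ℝ) - 4) / 2 * (4 / ((n : ℝ) - 4)) = ((2 : ℕ) : ℝ) := by
    field_simp
    norm_num
  rw [bubble, ← Real.rpow_mul (by positivity), h2, Real.rpow_natCast]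

/-- With `w = ε / (ε² + |x|²)` the round metric is `w²` times the Euclidean one. The linearized Weyl
tensor contributes `w² · w²` after squaring, the four inverse metrics `w⁻⁸`, and the volume density
`wⁿ`. -/
theorem integrand_eq (hn : 5 ≤ n) {ε : ℝ} (hε : 0 < ε) {T : Tensor2 n}
    (hT : ∀ i j, ContDiff ℝ ∞ fun y => T y i j) (hs : ∀ y, (T y).IsSymm) (x : Pt n) :
    normSq4 (roundMetric n ε) x (linWeyl (roundMetric n ε) (bubbleScale ε T) x)
        * Real.sqrt (roundMetric n ε x).det
      = (ε / (ε ^ 2 + ‖x‖ ^ 2)) ^ (n - 4) * flatWeylSq T x := by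
  set φ : Pt n → ℝ := fun y => (ε / (ε ^ 2 + ‖y‖ ^ 2)) ^ 2 with hφ
  have hden : ∀ y : Pt n, 0 < ε ^ 2 + ‖y‖ ^ 2 := fun y => by positivity
  have hφs : ContDiff ℝ ∞ φ :=
    (contDiff_const.div (contDiff_const.add (contDiff_norm_sq ℝ)) fun y => (hden y).ne').pow 2
  have hpos : ∀ y, 0 < φ y := fun y => pow_pos (div_pos hε (hden y)) 2
  have hg : roundMetric n ε = fun y => φ y • 1 := funext fun y => by
    simp only [roundMetric, bubbleScale, bubble_rpow hn hε, hφ]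
  have hh : bubbleScale ε T = fun y => φ y • T y := funext fun y => by
    simp only [bubbleScale, bubble_rpow hn hε, hφ]
  have hw : 0 < ε / (ε ^ 2 + ‖x‖ ^ 2) := div_pos hε (hden x)
  rw [normSq4_smul_one (hpos x).ne' (by rw [hg]), hg, hh]
  simp only [linWeyl_conformallyFlat (by omega) hT hs hφs hpos, mul_pow, ← Finset.mul_sum]
  rw [← flatWeylSq, Matrix.det_smul, Matrix.det_one, mul_one, Fintype.card_fin]
  simp only [hφ]
  rw [pow_right_comm _ 2 n, Real.sqrt_sq (pow_nonneg hw.le n)]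
  obtain ⟨m, rfl⟩ : ∃ m, n = m + 4 := ⟨n - 4, by omega⟩
  rw [Nat.add_sub_cancel, pow_add]
  field_simp

/-! ### Polynomial tensors with vanishing linearized Weyl tensor -/

section PolynomialAlgebra

open MvPolynomial

/-- The polynomial ring in the coordinates. -/
abbrev Poly (n : ℕ) : Type := MvPolynomial (Fin n) ℝ

/-- The Laplacian of a polynomial. -/
def lap (f : Poly n) : Poly n := ∑ i, pderiv i (pderiv i f)

/-- The polynomial `|x|²`. -/
def normSqPoly (n : ℕ) : Poly n := ∑ i, X i * X i

theorem pderiv_X_eq_ite (i j : Fin n) :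
    pderiv i (X j : Poly n) = if i = j then 1 else 0 := by
  rw [pderiv_X, Pi.single_apply]
  simp only [eq_comm]

theorem pderiv_mul' (i : Fin n) (f g : Poly n) :
    pderiv i (f * g) = pderiv i f * g + f * pderiv i g := pderiv_mul

theorem pderiv_pderiv_comm (i j : Fin n) (f : Poly n) :
    pderiv i (pderiv j f) = pderiv j (pderiv i f) := by
  induction f using MvPolynomial.induction_on with
  | C a => simp
  | add p q hp hq => simp [hp, hq]
  | mul_X p k hp =>
    have h : ∀ a b : Fin n, pderiv a (pderiv b (X k : Poly n)) = 0 := fun a b => by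
      rw [pderiv_X_eq_ite]
      split_ifs <;> simp
    simp only [pderiv_mul', map_add, h, hp]
    ring

theorem pderiv_natCast_mul (i : Fin n) (c : ℕ) (f : Poly n) :
    pderiv i ((c : Poly n) * f) = c * pderiv i f := by
  rw [pderiv_mul']
  simp

theorem pderiv_sum_mul_X (i : Fin n) (w : Fin n → Poly n) :
    pderiv i (∑ j, X j * w j) = w i + ∑ j, X j * pderiv i (w j) := by
  simp only [map_sum, pderiv_mul', pderiv_X_eq_ite, ite_mul, one_mul, zero_mul,
    Finset.sum_add_distrib, Finset.sum_ite_eq, Finset.mem_univ, if_true]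

theorem pderiv_normSqPoly (i : Fin n) : pderiv i (normSqPoly n) = 2 * X i := by
  rw [normSqPoly, pderiv_sum_mul_X]
  simp only [pderiv_X_eq_ite, mul_ite, mul_one, mul_zero, Finset.sum_ite_eq, Finset.mem_univ,
    if_true]
  ring

theorem euler {f : Poly n} {k : ℕ} (hf : f.IsHomogeneous k) :
    ∑ i, X i * pderiv i f = (k : Poly n) * f := by
  rw [hf.sum_X_mul_pderiv, nsmul_eq_mul]

theorem lap_isHomogeneous {f : Poly n} {m : ℕ} (hf : f.IsHomogeneous (m + 2)) :
    (lap f).IsHomogeneous m :=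
  IsHomogeneous.sum _ _ _ fun _ _ => hf.pderiv.pderiv

theorem lap_normSqPoly_mul {g : Poly n} {m : ℕ} (hg : g.IsHomogeneous m) :
    lap (normSqPoly n * g) = (2 * (n : Poly n) + 4 * (m : Poly n)) * g + normSqPoly n * lap g := by
  have h : ∀ i, pderiv i (pderiv i (normSqPoly n * g))
      = 2 * g + 4 * (X i * pderiv i g) + normSqPoly n * pderiv i (pderiv i g) := fun i => by
    have h2 : (2 : Poly n) = ((2 : ℕ) : Poly n) := rfl
    rw [pderiv_mul', pderiv_normSqPoly, map_add, pderiv_mul', pderiv_mul', pderiv_mul',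
      pderiv_normSqPoly, pderiv_X_eq_ite, if_pos rfl, h2, Derivation.map_natCast]
    push_cast
    ring
  simp only [lap, h, Finset.sum_add_distrib, ← Finset.mul_sum, euler hg]
  simp
  ring

theorem normSqPoly_ne_zero (hn : 0 < n) : normSqPoly n ≠ 0 := by
  intro h
  have := congrArg (eval fun _ => (1 : ℝ)) h
  simp [normSqPoly] at this
  omega

/-- The operator `|x|² Δ` on homogeneous polynomials of degree `k` has no eigenvalue outside
`[0, k (k + n - 2)]`. -/
theorem eq_zero_of_normSqPoly_mul_lap (hn : 2 ≤ n) (k : ℕ) : ∀ (f : Poly n) (c : ℝ),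
    f.IsHomogeneous k → (c < 0 ∨ (k : ℝ) * (k + n - 2) < c) →
    normSqPoly n * lap f = C c * f → f = 0 := by
  have hn' : (2 : ℝ) ≤ n := by exact_mod_cast hn
  induction k using Nat.strong_induction_on with
  | _ k ih =>
    intro f c hf hc h
    have hc0 : c ≠ 0 := by
      rcases hc with hc | hc
      · exact hc.ne
      · have : (0 : ℝ) ≤ (k : ℝ) * (k + n - 2) := by
          apply mul_nonneg (Nat.cast_nonneg k)
          have := Nat.cast_nonneg (α := ℝ) k
          linarith
        exact (this.trans_lt hc).ne'
    suffices hl : lap f = 0 by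
      rw [hl, mul_zero] at h
      rcases mul_eq_zero.1 h.symm with h1 | h1
      · exact absurd (C_eq_zero.1 h1) hc0
      · exact h1
    rcases Nat.lt_or_ge k 2 with hk | hk
    · refine Finset.sum_eq_zero fun i _ => ?_
      have h0 : (pderiv i f).IsHomogeneous 0 := by
        have := hf.pderiv (i := i)
        rwa [show k - 1 = 0 by omega] at this
      rw [totalDegree_eq_zero_iff_eq_C.1 (Nat.le_zero.1 h0.totalDegree_le), pderiv_C]
    · obtain ⟨m, rfl⟩ : ∃ m, k = m + 2 := ⟨k - 2, by omega⟩
      have hg := lap_isHomogeneous hf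
      -- Applying `Δ` to the equation and using `Δ(|x|² g) = (2n + 4m) g + |x|² Δ g` for `g = Δ f`
      -- shifts the eigenvalue by `2n + 4m`. The upper bound shifts exactly along: `(m + 2)(m + n) -
      -- 2n - 4m = m (m + n - 2)`.
      refine ih m (by omega) (lap f) (c - 2 * n - 4 * m) hg ?_ ?_
      · push_cast at hc
        have := Nat.cast_nonneg (α := ℝ) m
        rcases hc with hc | hc
        · left; linarith
        · right; nlinarith
      · have h2 := congrArg lap h
        rw [lap_normSqPoly_mul hg] at h2
        have h3 : lap (C c * f) = C c * lap f := by
          simp only [lap, Finset.mul_sum, pderiv_C_mul]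
        rw [h3] at h2
        simp only [map_sub, map_mul, map_natCast, map_ofNat]
        linear_combination h2

/-! ### Injectivity of the linearized Weyl tensor in a fixed degree -/

section Vanishing

variable {H P : Fin n → Fin n → Poly n} {m : ℕ}

theorem sum_X_mul_pderiv_of_radial (hx : ∀ j, ∑ i, X i * H i j = 0) (a j : Fin n) :
    ∑ i, X i * pderiv a (H i j) = -H a j := by
  have h := congrArg (pderiv a) (hx j)
  rw [pderiv_sum_mul_X, map_zero] at h
  linear_combination h

theorem sum_X_mul_pderiv_pderiv_of_radial (hx : ∀ j, ∑ i, X i * H i j = 0) (a b j : Fin n) :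
    ∑ i, X i * pderiv a (pderiv b (H i j)) = -pderiv a (H b j) - pderiv b (H a j) := by
  have h := congrArg (pderiv a) (sum_X_mul_pderiv_of_radial hx b j)
  rw [pderiv_sum_mul_X, map_neg] at h
  linear_combination h

/-- A homogeneous symmetric tracefree radially-free polynomial tensor whose linearized Riemann
tensor is a Kulkarni-Nomizu product with the Euclidean metric vanishes. -/
theorem eq_zero_of_linRiemann_eq_kulkarniNomizu (hn : 4 ≤ n)
    (hH : ∀ i j, (H i j).IsHomogeneous (m + 2)) (hP : ∀ i j, (P i j).IsHomogeneous m)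
    (hHs : ∀ i j, H i j = H j i) (hPs : ∀ i j, P i j = P j i)
    (hx : ∀ j, ∑ i, X i * H i j = 0) (htr : ∑ i, H i i = 0)
    (hA : ∀ i j k l, pderiv i (pderiv k (H j l)) + pderiv j (pderiv l (H i k))
        - pderiv i (pderiv l (H j k)) - pderiv j (pderiv k (H i l))
      = P i k * (if j = l then 1 else 0) + P j l * (if i = k then 1 else 0)
        - P i l * (if j = k then 1 else 0) - P j k * (if i = l then 1 else 0)) (i j : Fin n) :
    H i j = 0 := by
  have hn4 : (4 : ℝ) ≤ n := by exact_mod_cast hn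
  set δ : Fin n → Fin n → Poly n := fun a b => if a = b then 1 else 0 with hδ
  have hδsum : ∀ (w : Fin n → Poly n) a, ∑ b, w b * δ b a = w a := fun w a => by simp [hδ]
  -- The unknowns of the overdetermined system: `V = P(x, ·)`, `s = P(x, x)`, `τ = tr P`, `D = div
  -- H` and `ρ = |x|²`.
  set V : Fin n → Poly n := fun l => ∑ i, X i * P i l with hV
  set s : Poly n := ∑ l, X l * V l with hs
  set τ : Poly n := ∑ i, P i i with hτ
  set D : Fin n → Poly n := fun j => ∑ i, pderiv i (H i j) with hD
  set ρ : Poly n := normSqPoly n with hρ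
  have hVh : ∀ l, (V l).IsHomogeneous (m + 1) := fun l =>
    IsHomogeneous.sum _ _ _ fun i _ => by
      rw [add_comm]; exact (isHomogeneous_X ℝ i).mul (hP i l)
  have hsh : s.IsHomogeneous (m + 2) := IsHomogeneous.sum _ _ _ fun i _ => by
      rw [show m + 2 = 1 + (m + 1) by ring]; exact (isHomogeneous_X ℝ i).mul (hVh i)
  have hτh : τ.IsHomogeneous m := IsHomogeneous.sum _ _ _ fun i _ => hP i i
  have eH' : ∀ a j l, ∑ i, X i * pderiv i (pderiv a (H j l)) = ((m : Poly n) + 1) * pderiv a (H j l) :=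
    fun a j l => by
      have := euler ((hH j l).pderiv (i := a))
      push_cast at this
      exact this
  have r1 := sum_X_mul_pderiv_of_radial hx
  have r2 := sum_X_mul_pderiv_pderiv_of_radial hx
  -- the radial contraction
  have S1 : ∀ j k l, ((m : Poly n) + 2) * (pderiv k (H j l) - pderiv l (H j k))
      = V k * δ j l + P j l * X k - V l * δ j k - P j k * X l := by
    intro j k l
    have h1 : ∑ i, X i * (pderiv i (pderiv k (H j l)) + pderiv j (pderiv l (H i k))
        - pderiv i (pderiv l (H j k)) - pderiv j (pderiv k (H i l)))
        = ((m : Poly n) + 2) * (pderiv k (H j l) - pderiv l (H j k)) := by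
      simp only [mul_add, mul_sub, Finset.sum_add_distrib, Finset.sum_sub_distrib, eH', r2]
      rw [hHs l k]
      ring
    rw [← h1]
    simp only [hA]
    have e1 : ∀ a b, ∑ i, X i * (P i a * δ j b) = V a * δ j b := fun a b => by
      simp only [hV, Finset.sum_mul, mul_assoc]
    have e2 : ∀ a b, ∑ i, X i * (P j a * δ i b) = P j a * X b := fun a b => by
      rw [← hδsum X b, Finset.mul_sum]
      exact Finset.sum_congr rfl fun i _ => by ring
    simp only [mul_add, mul_sub, Finset.sum_add_distrib, Finset.sum_sub_distrib]
    rw [e1 k l, e2 l k, e1 l k, e2 k l]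
  have hrr : ∀ a j, ∑ k, X k * pderiv a (H j k) = -H j a := fun a j => by
    simp only [hHs j]
    exact r1 a j
  -- A second contraction with `x`, now of `S1`, removes all derivatives and expresses `H`
  -- algebraically through `P`.
  have S2 : ∀ j l, ((m : Poly n) + 2) * ((m : Poly n) + 3) * H j l
      = s * δ j l + ρ * P j l - V l * X j - V j * X l := by
    intro j l
    have h1 : ∑ k, X k * (((m : Poly n) + 2) * (pderiv k (H j l) - pderiv l (H j k)))
        = ((m : Poly n) + 2) * ((m : Poly n) + 3) * H j l := by
      simp only [mul_left_comm (X _), ← Finset.mul_sum, mul_sub, Finset.sum_sub_distrib,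
        hrr, euler (hH j l)]
      push_cast
      ring
    rw [← h1]
    simp only [S1]
    have e1 : ∑ k, X k * (V k * δ j l) = s * δ j l := by
      simp only [hs, Finset.sum_mul, mul_assoc]
    have e2 : ∑ k, X k * (P j l * X k) = ρ * P j l := by
      simp only [hρ, normSqPoly, Finset.sum_mul]
      exact Finset.sum_congr rfl fun i _ => by ring
    have e3 : ∑ k, X k * (V l * δ j k) = V l * X j := by simp [hδ, mul_comm]
    have e4 : ∑ k, X k * (P j k * X l) = V j * X l := by
      simp only [hV, Finset.sum_mul]
      exact Finset.sum_congr rfl fun i _ => by rw [hPs j i]; ring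
    simp only [mul_add, mul_sub, Finset.sum_add_distrib, Finset.sum_sub_distrib]
    rw [e1, e2, e3, e4]
  have hδ1 : ∑ j : Fin n, δ j j = (n : Poly n) := by simp [hδ]
  -- traces
  have S3 : ∀ k, -(((m : Poly n) + 2) * D k) = ((n : Poly n) - 2) * V k + τ * X k := by
    intro k
    have h1 : ∑ j, ((m : Poly n) + 2) * (pderiv k (H j j) - pderiv j (H j k))
        = -(((m : Poly n) + 2) * D k) := by
      rw [← Finset.mul_sum, Finset.sum_sub_distrib, ← map_sum, htr, map_zero]
      ring
    rw [← h1]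
    simp only [S1]
    have e1 : ∑ j, V k * δ j j = V k * n := by rw [← Finset.mul_sum, hδ1]
    have e2 : ∑ j, P j j * X k = τ * X k := by rw [← Finset.sum_mul]
    have e3 : ∑ j, V j * δ j k = V k := hδsum V k
    have e4 : ∑ j, P j k * X j = V k := by simp only [hV, mul_comm]
    simp only [Finset.sum_add_distrib, Finset.sum_sub_distrib]
    rw [e1, e2, e3, e4]
    ring
  have S4 : ((n : Poly n) - 2) * s = -(ρ * τ) := by
    have h1 : ∑ j, ((m : Poly n) + 2) * ((m : Poly n) + 3) * H j j = 0 := by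
      rw [← Finset.mul_sum, htr, mul_zero]
    simp only [S2] at h1
    have e1 : ∑ j, s * δ j j = s * n := by rw [← Finset.mul_sum, hδ1]
    have e2 : ∑ j, ρ * P j j = ρ * τ := by rw [← Finset.mul_sum]
    have e3 : ∑ j, V j * X j = s := by simp only [hs, mul_comm]
    simp only [Finset.sum_add_distrib, Finset.sum_sub_distrib] at h1
    rw [e1, e2, e3] at h1
    linear_combination h1
  -- The trace of `hA` over `i = k`, that is, the Ricci part of the equation.
  have S5 : ∀ j l, ((n : Poly n) - 2) * P j l + τ * δ j l
      = lap (H j l) - pderiv l (D j) - pderiv j (D l) := by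
    intro j l
    have h1 : ∑ i, (pderiv i (pderiv i (H j l)) + pderiv j (pderiv l (H i i))
        - pderiv i (pderiv l (H j i)) - pderiv j (pderiv i (H i l)))
        = lap (H j l) - pderiv l (D j) - pderiv j (D l) := by
      simp only [Finset.sum_add_distrib, Finset.sum_sub_distrib, ← map_sum, htr, map_zero, add_zero]
      congr 1
      congr 1
      simp only [hD, map_sum]
      exact Finset.sum_congr rfl fun i _ => by rw [pderiv_pderiv_comm, hHs j i]
    rw [← h1]
    rw [Finset.sum_congr rfl fun i _ => hA i j i l]
    change _ = ∑ i, (P i i * δ j l + P j l * δ i i - P i l * δ j i - P j i * δ i l)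
    have e1 : ∑ i, P i i * δ j l = τ * δ j l := by rw [← Finset.sum_mul]
    have e2 : ∑ i, P j l * δ i i = P j l * n := by rw [← Finset.mul_sum, hδ1]
    have e3 : ∑ i, P i l * δ j i = P j l := by simp [hδ]
    have e4 : ∑ i, P j i * δ i l = P j l := hδsum (P j) l
    simp only [Finset.sum_add_distrib, Finset.sum_sub_distrib]
    rw [e1, e2, e3, e4]
    ring
  have S6 : -(∑ j, pderiv j (D j)) = ((n : Poly n) - 1) * τ := by
    have h1 : ∑ j, (lap (H j j) - pderiv j (D j) - pderiv j (D j))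
        = -2 * ∑ j, pderiv j (D j) := by
      have e : ∑ j, lap (H j j) = 0 := by
        simp only [lap]
        rw [Finset.sum_comm]
        simp only [← map_sum, htr, map_zero, Finset.sum_const_zero]
      rw [Finset.sum_sub_distrib, Finset.sum_sub_distrib, e]
      ring
    simp only [← S5] at h1
    have e1 : ∑ j, τ * δ j j = τ * n := by rw [← Finset.mul_sum, hδ1]
    rw [Finset.sum_add_distrib, ← Finset.mul_sum, e1] at h1
    have h2 : (2 : Poly n) ≠ 0 := by norm_num
    refine mul_left_cancel₀ h2 ?_
    linear_combination -h1
  have pn : ∀ (i : Fin n) (k : ℕ) (f : Poly n), pderiv i ((k : Poly n) * f) = k * pderiv i f :=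
    pderiv_natCast_mul
  have n2 : ((n : Poly n) - 2) = ((n - 2 : ℕ) : Poly n) := by
    rw [Nat.cast_sub (by omega)]; norm_num
  have n1 : ((n : Poly n) - 1) = ((n - 1 : ℕ) : Poly n) := by
    rw [Nat.cast_sub (by omega)]; norm_num
  have m23 : ((m : Poly n) + 2) * ((m : Poly n) + 3) = (((m + 2) * (m + 3) : ℕ) : Poly n) := by
    push_cast; ring
  have m2 : (m : Poly n) + 2 = ((m + 2 : ℕ) : Poly n) := by push_cast; ring
  have ncne : ∀ k : ℕ, k ≠ 0 → (k : Poly n) ≠ 0 := fun k hk => Nat.cast_ne_zero.2 hk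
  have pδ : ∀ (i : Fin n) (f : Poly n) a b, pderiv i (f * δ a b) = pderiv i f * δ a b :=
    fun i f a b => by
      simp only [hδ]
      split_ifs <;> simp
  -- divergence of `P`
  have S7 : ∀ l, ∑ j, pderiv j (P j l) = pderiv l τ := by
    intro l
    have h1 : ∑ j, pderiv j (lap (H j l) - pderiv l (D j) - pderiv j (D l))
        = -pderiv l (∑ j, pderiv j (D j)) := by
      have e1 : ∑ j, pderiv j (lap (H j l)) = ∑ j, pderiv j (pderiv j (D l)) := by
        simp only [lap, hD, map_sum]
        rw [Finset.sum_comm]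
        refine Finset.sum_congr rfl fun a _ => Finset.sum_congr rfl fun b _ => ?_
        rw [pderiv_pderiv_comm b a, pderiv_pderiv_comm b a]
      simp only [map_sub, Finset.sum_sub_distrib, map_sum (pderiv l), pderiv_pderiv_comm _ l] at e1 ⊢
      rw [e1]
      simp only [pderiv_pderiv_comm l]
      ring
    rw [← map_neg, S6] at h1
    simp only [← S5, map_add, n2, n1, pn, pδ, Finset.sum_add_distrib, ← Finset.mul_sum] at h1
    rw [hδsum (fun j => pderiv j τ) l, ← n2, ← n1] at h1
    refine mul_left_cancel₀ (n2 ▸ ncne (n - 2) (by omega)) ?_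
    linear_combination h1
  have S8 : ∑ l, pderiv l (V l) = ((m : Poly n) + 1) * τ := by
    have e : ∀ l, pderiv l (V l) = P l l + ∑ i, X i * pderiv l (P i l) := fun l =>
      pderiv_sum_mul_X l _
    simp only [e]
    rw [Finset.sum_add_distrib, Finset.sum_comm]
    simp only [← Finset.mul_sum]
    have e2 : ∀ i, ∑ l, pderiv l (P i l) = pderiv i τ := fun i => by
      rw [← S7]
      exact Finset.sum_congr rfl fun l _ => by rw [hPs]
    simp only [e2, euler hτh]
    ring
  -- divergence of the formula for `H`
  have S9 : ∀ l, ((m : Poly n) + 2) * ((m : Poly n) + 3) * D l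
      = pderiv l s + ρ * pderiv l τ - ((m : Poly n) + (n : Poly n)) * V l - ((m : Poly n) + 1) * τ * X l := by
    intro l
    have h1 : ∑ j, pderiv j (((m : Poly n) + 2) * ((m : Poly n) + 3) * H j l)
        = ((m : Poly n) + 2) * ((m : Poly n) + 3) * D l := by
      rw [m23]
      simp only [pn, ← Finset.mul_sum, hD]
    rw [← h1]
    simp only [S2, map_add, map_sub, pδ, Finset.sum_add_distrib, Finset.sum_sub_distrib]
    rw [hδsum (fun j => pderiv j s) l]
    have e2 : ∑ j, pderiv j (ρ * P j l) = 2 * V l + ρ * pderiv l τ := by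
      rw [← S7 l]
      simp only [pderiv_mul', hρ, pderiv_normSqPoly, Finset.sum_add_distrib, hV, Finset.mul_sum,
        mul_assoc]
    have e3 : ∑ j, pderiv j (V l * X j) = ((m : Poly n) + 1) * V l + (n : Poly n) * V l := by
      have := euler (hVh l)
      push_cast at this
      rw [← this]
      simp only [pderiv_mul', pderiv_X_eq_ite, if_true, Finset.sum_add_distrib, mul_comm]
      simp [add_comm]
    have e4 : ∑ j, pderiv j (V j * X l) = ((m : Poly n) + 1) * τ * X l + V l := by
      simp only [pderiv_mul', pderiv_X_eq_ite, Finset.sum_add_distrib, mul_ite, mul_one, mul_zero,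
        Finset.sum_ite_eq', Finset.mem_univ, if_true, ← Finset.sum_mul, S8]
    rw [e2, e3, e4]
    ring
  -- `D` is eliminated between `S3` and `S9`, and `τ` by the gradient of `S4`. The remaining common
  -- factor is `n - 3`.
  have S10 : ∀ l, ((m : Poly n) + 2) * V l = pderiv l s := by
    intro l
    have h1 : ((n : Poly n) - 2) * pderiv l s = -(2 * X l * τ + ρ * pderiv l τ) := by
      have := congrArg (pderiv l) S4
      rwa [n2, pn, ← n2, map_neg, pderiv_mul', hρ, pderiv_normSqPoly] at this
    have h3 : (n : Poly n) - 3 ≠ 0 := by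
      have : ((n : Poly n) - 3) = ((n - 3 : ℕ) : Poly n) := by
        rw [Nat.cast_sub (by omega)]; norm_num
      rw [this]
      exact ncne _ (by omega)
    refine mul_left_cancel₀ h3 ?_
    linear_combination -((m : Poly n) + 3) * S3 l - S9 l - h1
  -- The divergence of `S10`, with `div V` from `S8` and `τ` from `S4`, closes up to an equation for
  -- `s` alone. Its eigenvalue is negative, which forces `s = 0`.
  have S11 : ρ * lap s = C (-(((m : ℝ) + 2) * (m + 1) * (n - 2))) * s := by
    have h1 : lap s = ((m : Poly n) + 2) * (((m : Poly n) + 1) * τ) := by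
      simp only [lap, ← S10]
      rw [m2]
      simp only [pn, ← Finset.mul_sum, S8]
    rw [h1]
    simp only [map_neg, map_mul, map_add, map_sub, map_natCast, map_ofNat, map_one]
    linear_combination ((m : Poly n) + 2) * ((m : Poly n) + 1) * S4
  have hmn : (0 : ℝ) ≤ m := Nat.cast_nonneg m
  have s0 : s = 0 := by
    refine eq_zero_of_normSqPoly_mul_lap (by omega) (m + 2) s _ hsh (Or.inl ?_) S11
    have : 0 < ((m : ℝ) + 2) * (m + 1) * (n - 2) := by
      have : (0 : ℝ) < n - 2 := by linarith
      positivity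
    linarith
  have τ0 : τ = 0 := by
    rw [s0, mul_zero] at S4
    rcases mul_eq_zero.1 (neg_eq_zero.1 S4.symm) with h | h
    · exact absurd h (normSqPoly_ne_zero (by omega))
    · exact h
  have V0 : ∀ l, V l = 0 := fun l => by
    have := S10 l
    rw [s0, map_zero, m2] at this
    exact (mul_eq_zero.1 this).resolve_left (ncne _ (by omega))
  have D0 : ∀ l, D l = 0 := fun l => by
    have := S3 l
    rw [V0, τ0, mul_zero, zero_mul, zero_add, neg_eq_zero, m2] at this
    exact (mul_eq_zero.1 this).resolve_left (ncne _ (by omega))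
  have h1 := S2 i j
  have h2 := S5 i j
  rw [s0, V0, V0, zero_mul, zero_mul, zero_mul, zero_add, sub_zero, sub_zero] at h1
  rw [τ0, D0, D0, map_zero, map_zero, zero_mul, add_zero, sub_zero, sub_zero] at h2
  -- Now `(m + 2)(m + 3) H = ρ P` and `(n - 2) P = Δ H`. The resulting eigenvalue exceeds the upper
  -- bound `(m + 2)(m + n)`, because `(n - 2)(m + 3) - (m + n) = (n - 3)(m + 2) > 0`.
  refine eq_zero_of_normSqPoly_mul_lap (by omega) (m + 2) (H i j)
    (((n : ℝ) - 2) * ((m + 2) * (m + 3))) (hH i j) (Or.inr ?_) ?_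
  · push_cast
    nlinarith [mul_pos (show (0 : ℝ) < n - 3 by linarith) (show (0 : ℝ) < (m : ℝ) + 2 by linarith)]
  · simp only [map_mul, map_add, map_sub, map_natCast, map_ofNat]
    rw [← h2]
    linear_combination -((n : Poly n) - 2) * h1

end Vanishing

end PolynomialAlgebra

/-! ### The linearized Weyl tensor of a polynomial tensor -/

section PolynomialWeyl

open MvPolynomial

/-- A matrix of polynomials. -/
abbrev PolyMatrix (n : ℕ) : Type := Matrix (Fin n) (Fin n) (Poly n)

/-- The linearized Riemann tensor of a polynomial tensor. -/
def polyRiem (H : PolyMatrix n) (i j k l : Fin n) : Poly n :=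
  C (1 / 2) * (pderiv i (pderiv k (H j l)) + pderiv j (pderiv l (H i k))
    - pderiv i (pderiv l (H j k)) - pderiv j (pderiv k (H i l)))

/-- The linearized Ricci tensor of a polynomial tensor. -/
def polyRic (H : PolyMatrix n) (j k : Fin n) : Poly n := ∑ i, polyRiem H i j k i

/-- The linearized scalar curvature of a polynomial tensor. -/
def polyScal (H : PolyMatrix n) : Poly n := ∑ j, polyRic H j j

/-- The linearized Schouten tensor of a polynomial tensor. -/
def polySchouten (H : PolyMatrix n) (i j : Fin n) : Poly n :=
  C (1 / ((n : ℝ) - 2)) * (polyRic H i j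
    - C (1 / (2 * ((n : ℝ) - 1))) * if i = j then polyScal H else 0)

/-- The linearized Weyl tensor of a polynomial tensor. -/
def polyWeyl (H : PolyMatrix n) (i j k l : Fin n) : Poly n :=
  polyRiem H i j k l
    - ((if j = k then polySchouten H i l else 0) + (if i = l then polySchouten H j k else 0)
      - (if j = l then polySchouten H i k else 0) - (if i = k then polySchouten H j l else 0))

theorem polyWeyl_add (H K : PolyMatrix n) (i j k l : Fin n) :
    polyWeyl (H + K) i j k l = polyWeyl H i j k l + polyWeyl K i j k l := by
  have h1 : ∀ i j k l, polyRiem (H + K) i j k l = polyRiem H i j k l + polyRiem K i j k l := by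
    intro i j k l
    simp only [polyRiem, Matrix.add_apply, map_add]
    ring
  have h2 : ∀ j k, polyRic (H + K) j k = polyRic H j k + polyRic K j k := fun j k => by
    simp only [polyRic, h1, Finset.sum_add_distrib]
  have h3 : polyScal (H + K) = polyScal H + polyScal K := by
    simp only [polyScal, h2, Finset.sum_add_distrib]
  have h4 : ∀ i j, polySchouten (H + K) i j = polySchouten H i j + polySchouten K i j := by
    intro i j
    simp only [polySchouten, h2, h3]
    split_ifs <;> ring
  simp only [polyWeyl, h1, h4]
  split_ifs <;> ring

theorem linearMap_C_mul (L : Poly n →ₗ[ℝ] Poly n) (c : ℝ) (f : Poly n) :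
    L (C c * f) = C c * L f := by
  rw [← smul_eq_C_mul, map_smul, smul_eq_C_mul]

/-- The linearized Weyl tensor commutes with operators commuting with second derivatives. -/
theorem polyWeyl_map {L L' : Poly n →ₗ[ℝ] Poly n}
    (hL : ∀ i j f, pderiv i (pderiv j (L f)) = L' (pderiv i (pderiv j f))) (H : PolyMatrix n)
    (i j k l : Fin n) : polyWeyl (H.map L) i j k l = L' (polyWeyl H i j k l) := by
  have h1 : ∀ i j k l, polyRiem (H.map L) i j k l = L' (polyRiem H i j k l) := fun i j k l => by
    simp only [polyRiem, Matrix.map_apply, hL, linearMap_C_mul, map_sub, map_add]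
  have h2 : ∀ j k, polyRic (H.map L) j k = L' (polyRic H j k) := fun j k => by
    simp only [polyRic, h1, map_sum]
  have h3 : polyScal (H.map L) = L' (polyScal H) := by
    simp only [polyScal, h2, map_sum]
  have h4 : ∀ i j, polySchouten (H.map L) i j = L' (polySchouten H i j) := fun i j => by
    simp only [polySchouten, h2, h3, linearMap_C_mul, map_sub, apply_ite L', map_zero]
  simp only [polyWeyl, h1, h4, map_sub, map_add, apply_ite L', map_zero]

theorem polyWeyl_smul (c : ℝ) (H : PolyMatrix n) (i j k l : Fin n) :
    polyWeyl (c • H) i j k l = c • polyWeyl H i j k l := by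
  have h : c • H = H.map (LinearMap.mulLeft ℝ (C c : Poly n)) := by
    ext1 i j
    rw [Matrix.smul_apply, Matrix.map_apply, LinearMap.mulLeft_apply, smul_eq_C_mul]
  rw [h, polyWeyl_map (L' := LinearMap.mulLeft ℝ (C c : Poly n)) (fun i j f => by
    rw [LinearMap.mulLeft_apply, LinearMap.mulLeft_apply, pderiv_C_mul, pderiv_C_mul]),
    LinearMap.mulLeft_apply, smul_eq_C_mul]

/-- The linearized Weyl tensor as a linear map. -/
def polyWeylLin (i j k l : Fin n) : PolyMatrix n →ₗ[ℝ] Poly n where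
  toFun H := polyWeyl H i j k l
  map_add' H K := polyWeyl_add H K i j k l
  map_smul' c H := polyWeyl_smul c H i j k l

theorem hasFDerivAt_eval (p : Poly n) (x : Pt n) :
    HasFDerivAt (fun y : Pt n => eval (fun a => y a) p)
      (∑ i, eval (fun a => x a) (pderiv i p) • (EuclideanSpace.proj i : Pt n →L[ℝ] ℝ)) x := by
  induction p using MvPolynomial.induction_on with
  | C a => simpa using hasFDerivAt_const a x
  | add p q hp hq =>
    simp only [map_add, add_smul, Finset.sum_add_distrib]
    exact hp.add hq
  | mul_X p k hp =>
    have h := hp.mul ((EuclideanSpace.proj k : Pt n →L[ℝ] ℝ).hasFDerivAt (x := x))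
    simp only [map_mul, eval_X]
    refine h.congr_fderiv ?_
    ext v
    simp only [pderiv_mul', pderiv_X_eq_ite, map_add, map_mul, eval_X, add_apply,
      smul_apply, sum_apply, smul_eq_mul, PiLp.proj_apply, mul_ite, mul_one,
      mul_zero, apply_ite (eval _), map_zero, add_mul, Finset.sum_add_distrib, ite_mul, zero_mul,
      Finset.sum_ite_eq', Finset.mem_univ, if_true, Finset.mul_sum]
    rw [add_comm]
    congr 1
    exact Finset.sum_congr rfl fun i _ => by ring

theorem pd_eval (p : Poly n) (i : Fin n) (x : Pt n) :
    pd i (fun y : Pt n => eval (fun a => y a) p) x = eval (fun a => x a) (pderiv i p) := by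
  rw [pd, (hasFDerivAt_eval p x).fderiv]
  simp [sum_apply]

theorem smooth_eval (p : Poly n) : ContDiff ℝ ∞ fun y : Pt n => eval (fun a => y a) p := by
  induction p using MvPolynomial.induction_on with
  | C a => simpa using contDiff_const
  | add p q hp hq => simpa using hp.add hq
  | mul_X p k hp =>
    simpa using hp.mul (EuclideanSpace.proj k : Pt n →L[ℝ] ℝ).contDiff

theorem flatWeyl_polyTensor (H : PolyMatrix n) (x : Pt n) (i j k l : Fin n) :
    flatWeyl (polyTensor H) x i j k l = eval (fun a => x a) (polyWeyl H i j k l) := by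
  have h1 : ∀ i j k l, linRiemann (polyTensor H) x i j k l
      = eval (fun a => x a) (polyRiem H i j k l) := fun i j k l => by
    have hpd : ∀ a b p, pd a (pd b fun y : Pt n => eval (fun a => y a) p) x
        = eval (fun a => x a) (pderiv a (pderiv b p)) := fun a b p => by
      rw [show (pd b fun y : Pt n => eval (fun a => y a) p)
        = fun y : Pt n => eval (fun a => y a) (pderiv b p) from funext fun y => pd_eval p b y,
        pd_eval]
    simp only [linRiemann, polyTensor, Matrix.of_apply, hpd, polyRiem, map_mul, eval_C, map_add, map_sub]
  have h2 : ∀ j k, ricciContr 1 (linRiemann (polyTensor H) x) j k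
      = eval (fun a => x a) (polyRic H j k) := fun j k => by
    simp [ricciContr, polyRic, h1, Matrix.one_apply]
  have h3 : scalarContr 1 (linRiemann (polyTensor H) x) = eval (fun a => x a) (polyScal H) := by
    simp [scalarContr, polyScal, h2, Matrix.one_apply]
  have h4 : ∀ i j, schoutenContr 1 (linRiemann (polyTensor H) x) i j
      = eval (fun a => x a) (polySchouten H i j) := fun i j => by
    simp only [schoutenContr, polySchouten, h2, h3, Matrix.one_apply, map_mul, eval_C, map_sub,
      apply_ite (eval _), map_zero, mul_ite, mul_one, mul_zero]
  simp only [flatWeyl, weylPart, kulkarniNomizu, Matrix.of_apply, h1, h4, Matrix.one_apply,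
    mul_ite, mul_one, mul_zero, polyWeyl, map_sub, map_add, apply_ite (eval _), map_zero]

/-- Polynomial tensors that are symmetric, tracefree and radially free. -/
structure IsRadialFree (H : PolyMatrix n) : Prop where
  symm : ∀ i j, H i j = H j i
  trace : ∑ i, H i i = 0
  radial : ∀ j, ∑ i, X i * H i j = 0

theorem eq_zero_of_polyWeyl_of_isHomogeneous (hn : 4 ≤ n) {m : ℕ} {H : PolyMatrix n}
    (hH : IsRadialFree H) (hom : ∀ i j, (H i j).IsHomogeneous (m + 2))
    (hW : ∀ i j k l, polyWeyl H i j k l = 0) (i j : Fin n) : H i j = 0 := by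
  have smul_hom : ∀ (c : ℝ) {f : Poly n}, f.IsHomogeneous m → (C c * f).IsHomogeneous m :=
    fun c f hf => by simpa using (isHomogeneous_C (Fin n) c).mul hf
  have hR : ∀ i j k l, (polyRiem H i j k l).IsHomogeneous m := fun i j k l => by
    have h : ∀ a b c d, (pderiv a (pderiv b (H c d))).IsHomogeneous m :=
      fun a b c d => (hom c d).pderiv.pderiv
    exact smul_hom _ ((((h _ _ _ _).add (h _ _ _ _)).sub (h _ _ _ _)).sub (h _ _ _ _))
  have hRic : ∀ j k, (polyRic H j k).IsHomogeneous m := fun j k =>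
    IsHomogeneous.sum _ _ _ fun i _ => hR _ _ _ _
  have hSc : (polyScal H).IsHomogeneous m := IsHomogeneous.sum _ _ _ fun i _ => hRic _ _
  have hS : ∀ i j, (polySchouten H i j).IsHomogeneous m := fun i j => by
    refine smul_hom _ ((hRic i j).sub (smul_hom _ ?_))
    split_ifs
    · exact hSc
    · exact isHomogeneous_zero _ _ _
  have hRicS : ∀ j k, polyRic H j k = polyRic H k j := fun j k => by
    simp only [polyRic, polyRiem]
    refine Finset.sum_congr rfl fun i _ => ?_
    rw [hH.symm j i, hH.symm k i, hH.symm j k, pderiv_pderiv_comm j i, pderiv_pderiv_comm i k,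
      pderiv_pderiv_comm j k]
    ring
  -- In the factor `-2`, the `2` clears the `1/2` in `polyRiem` and the sign matches the order of
  -- the indices in the vanishing theorem.
  refine eq_zero_of_linRiemann_eq_kulkarniNomizu (P := fun a b => C (-2) * polySchouten H a b)
    hn hom (fun a b => smul_hom _ (hS a b)) hH.symm (fun a b => ?_) hH.radial hH.trace
    (fun i j k l => ?_) i j
  · simp only [polySchouten, hRicS a b, eq_comm]
  · have h := hW i j k l
    rw [polyWeyl, sub_eq_zero, polyRiem] at h
    have hC : (2 : Poly n) * C (1 / 2) = 1 := by
      rw [← map_ofNat (C : ℝ →+* Poly n) 2, ← C_mul]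
      norm_num
    have hC2 : C (-2) = (-2 : Poly n) := by rw [map_neg, map_ofNat]
    have h3 := congrArg (2 * ·) h
    simp only [← mul_assoc, hC, one_mul] at h3
    rw [h3, hC2]
    split_ifs <;> ring

theorem homogeneousComponent_pderiv (m : ℕ) (i : Fin n) (f : Poly n) :
    pderiv i (homogeneousComponent (m + 1) f) = homogeneousComponent m (pderiv i f) := by
  ext α
  rw [coeff_pderiv, coeff_homogeneousComponent, coeff_homogeneousComponent, coeff_pderiv]
  have : (α + Finsupp.single i 1).degree = α.degree + 1 := by
    rw [map_add, Finsupp.degree_single]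
  rw [this]
  simp only [Nat.add_right_cancel_iff]
  split_ifs <;> simp

theorem homogeneousComponent_X_mul (m : ℕ) (i : Fin n) (f : Poly n) :
    homogeneousComponent (m + 1) (X i * f) = X i * homogeneousComponent m f := by
  ext α
  rw [coeff_homogeneousComponent, coeff_X_mul', coeff_X_mul', coeff_homogeneousComponent]
  by_cases h : i ∈ α.support
  · obtain ⟨β, rfl⟩ : ∃ β, α = β + Finsupp.single i 1 :=
      ⟨α - Finsupp.single i 1, (tsub_add_cancel_of_le (by
        rw [Finsupp.single_le_iff]
        exact Nat.one_le_iff_ne_zero.2 (Finsupp.mem_support_iff.1 h))).symm⟩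
    rw [if_pos h, if_pos h, add_tsub_cancel_right, map_add, Finsupp.degree_single]
    simp only [Nat.add_right_cancel_iff]
  · simp [h]

theorem IsRadialFree.homogeneousComponent {H : PolyMatrix n} (hH : IsRadialFree H) (m : ℕ) :
    IsRadialFree (H.map (MvPolynomial.homogeneousComponent m)) where
  symm i j := by rw [Matrix.map_apply, Matrix.map_apply, hH.symm]
  trace := by
    simp only [Matrix.map_apply, ← map_sum, hH.trace, map_zero]
  radial j := by
    simp only [Matrix.map_apply, ← homogeneousComponent_X_mul, ← map_sum, hH.radial, map_zero]

/-- The linearized Weyl tensor is injective on the radially free polynomial tensors without terms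
of degree less than two. -/
theorem eq_zero_of_polyWeyl (hn : 4 ≤ n) {H : PolyMatrix n} (hH : IsRadialFree H)
    (hdeg : ∀ i j, ∀ α ∈ (H i j).support, 2 ≤ α.degree)
    (hW : ∀ i j k l, polyWeyl H i j k l = 0) : H = 0 := by
  -- The Weyl operator is of second order with constant coefficients, so it sends the component of
  -- degree `m + 2` to the component of degree `m` of the full Weyl tensor, which vanishes.
  have key : ∀ m i j, MvPolynomial.homogeneousComponent (m + 2) (H i j) = 0 := fun m i j =>
    eq_zero_of_polyWeyl_of_isHomogeneous hn (hH.homogeneousComponent (m + 2))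
      (fun i j => homogeneousComponent_isHomogeneous _ _) (fun i j k l => by
        rw [polyWeyl_map (L' := MvPolynomial.homogeneousComponent m) (fun a b f => by
          rw [homogeneousComponent_pderiv, homogeneousComponent_pderiv]), hW, map_zero]) i j
  ext i j α
  rw [Matrix.zero_apply, coeff_zero]
  by_contra h
  have h2 := hdeg i j α (mem_support_iff.2 h)
  have h3 := congrArg (coeff α) (key (α.degree - 2) i j)
  rw [coeff_homogeneousComponent, if_pos (by omega), coeff_zero] at h3
  exact h h3

end PolynomialWeyl

/-! ### Rescaling of polynomial tensors -/

section Rescaling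

open MvPolynomial

/-- The substitution `x ↦ r x` in a polynomial. -/
def rescale (r : ℝ) : Poly n →ₐ[ℝ] Poly n := aeval fun i => C r * X i

theorem eval_rescale (r : ℝ) (f : Poly n) (x : Fin n → ℝ) :
    eval x (rescale r f) = eval (fun i => r * x i) f := by
  induction f using MvPolynomial.induction_on with
  | C a => simp [rescale]
  | add p q hp hq => simp [hp, hq]
  | mul_X p k hp => simp [hp]; simp [rescale]

theorem pderiv_rescale (r : ℝ) (i : Fin n) (f : Poly n) :
    pderiv i (rescale r f) = C r * rescale r (pderiv i f) := by
  have hX : ∀ k, rescale r (X k : Poly n) = C r * X k := fun k => by simp [rescale]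
  induction f using MvPolynomial.induction_on with
  | C a => simp [rescale]
  | add p q hp hq => simp [hp, hq, mul_add]
  | mul_X p k hp =>
    rw [map_mul, pderiv_mul', pderiv_mul', map_add, map_mul, map_mul, hp, hX, pderiv_C_mul,
      pderiv_X_eq_ite]
    split_ifs <;> simp <;> ring

theorem coeff_rescale (r : ℝ) (f : Poly n) (α : Fin n →₀ ℕ) :
    coeff α (rescale r f) = r ^ α.degree * coeff α f := by
  induction f using MvPolynomial.induction_on' with
  | monomial β a =>
    have h : rescale r (monomial β a) = monomial β (r ^ β.degree * a) := by
      rw [rescale, aeval_monomial, monomial_eq, C_mul, Finsupp.degree_eq_sum]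
      simp only [mul_pow, Finsupp.prod_mul, algebraMap_eq, C_pow]
      rw [Finsupp.prod_fintype (f := β) (g := fun _ k => (C r : Poly n) ^ k) (by simp),
        Finset.prod_pow_eq_pow_sum]
      ring
    rw [h, coeff_monomial, coeff_monomial]
    split_ifs with h1
    · rw [h1]
    · simp
  | add p q hp hq => simp [hp, hq, mul_add]

theorem IsRadialFree.rescale {H : PolyMatrix n} (hH : IsRadialFree H) {r : ℝ} (hr : r ≠ 0) :
    IsRadialFree (H.map (rescale r)) where
  symm i j := by rw [Matrix.map_apply, Matrix.map_apply, hH.symm]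
  trace := by
    simp only [Matrix.map_apply, ← map_sum, hH.trace, map_zero]
  radial j := by
    have h := congrArg (WeylBubble.rescale r) (hH.radial j)
    have hX : ∀ k, WeylBubble.rescale r (X k : Poly n) = C r * X k := fun k => by
      simp [WeylBubble.rescale]
    simp only [map_sum, map_mul, hX, mul_assoc, ← Finset.mul_sum, map_zero] at h
    exact (mul_eq_zero.1 h).resolve_left fun h0 => hr (C_eq_zero.1 h0)

theorem support_rescale_subset (r : ℝ) (f : Poly n) : (rescale r f).support ⊆ f.support := by
  intro α h
  rw [mem_support_iff, coeff_rescale] at h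
  exact mem_support_iff.2 (right_ne_zero_of_mul h)

theorem support_rescale {r : ℝ} (hr : r ≠ 0) (f : Poly n) :
    (rescale r f).support = f.support := by
  ext α
  simp [mem_support_iff, coeff_rescale, hr]

theorem coeffSq_rescale {r : ℝ} (hr : r ≠ 0) (H : PolyMatrix n) (k : ℕ) :
    coeffSq (H.map (rescale r)) k = r ^ (2 * k) * coeffSq H k := by
  simp only [coeffSq, Matrix.map_apply, support_rescale hr, Finset.mul_sum]
  refine Finset.sum_congr rfl fun i _ => Finset.sum_congr rfl fun j _ =>
    Finset.sum_congr rfl fun α hα => ?_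
  rw [coeff_rescale, (Finset.mem_filter.1 hα).2]
  ring

/-- Two derivatives produce `r²`, and squaring produces `r⁴`. -/
theorem flatWeylSq_rescale (r : ℝ) (H : PolyMatrix n) (x : Pt n) :
    flatWeylSq (polyTensor (H.map (rescale r))) x
      = r ^ 4 * flatWeylSq (polyTensor H) (r • x) := by
  have h : ∀ i j k l, polyWeyl (H.map (rescale r)) i j k l
      = C r * (C r * rescale r (polyWeyl H i j k l)) := fun i j k l =>
    polyWeyl_map (L := (rescale r).toLinearMap)
      (L' := LinearMap.mulLeft ℝ (C r : Poly n) ∘ₗ LinearMap.mulLeft ℝ (C r : Poly n)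
        ∘ₗ (rescale r).toLinearMap)
      (fun a b f => by
        simp only [AlgHom.toLinearMap_apply, LinearMap.comp_apply, LinearMap.mulLeft_apply,
          pderiv_rescale, pderiv_C_mul]) H i j k l
  simp only [flatWeylSq, flatWeyl_polyTensor, h, map_mul, eval_C, eval_rescale, Finset.mul_sum]
  refine Finset.sum_congr rfl fun i _ => Finset.sum_congr rfl fun j _ =>
    Finset.sum_congr rfl fun k _ => Finset.sum_congr rfl fun l _ => ?_
  simp only [PiLp.smul_apply, smul_eq_mul]
  ring

end Rescaling

/-! ### Polynomials vanishing to high order -/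

section Taylor

open MvPolynomial

/-- Otherwise `q = t^j r` with `r(0) ≠ 0` and `j ≤ m`. Dividing the bound by `t^j` gives `|r(t)| ≤ c
|t|` near `0`, contradicting `r(0) ≠ 0`. -/
theorem polynomial_eq_zero_of_isBigO {q : Polynomial ℝ} {m : ℕ} (hq : q.natDegree ≤ m)
    (h : (fun t => q.eval t) =O[𝓝 0] fun t : ℝ => t ^ (m + 1)) : q = 0 := by
  by_contra h0
  obtain ⟨r, hr, hnd⟩ := Polynomial.exists_eq_pow_rootMultiplicity_mul_and_not_dvd q h0 0
  set j := q.rootMultiplicity 0 with hj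
  rw [Polynomial.dvd_iff_isRoot, Polynomial.IsRoot.def] at hnd
  have hjm : j ≤ m := by
    have := Polynomial.natDegree_le_of_dvd (Polynomial.pow_rootMultiplicity_dvd q 0) h0
    rw [Polynomial.natDegree_pow, Polynomial.natDegree_X_sub_C, mul_one] at this
    exact this.trans hq
  obtain ⟨c, hc⟩ := h.bound
  have h1 : ∀ᶠ t in 𝓝[≠] (0 : ℝ), ‖r.eval t‖ ≤ c * ‖t‖ := by
    have hsmall : ∀ᶠ t in 𝓝 (0 : ℝ), ‖t‖ ≤ 1 := by
      filter_upwards [Metric.closedBall_mem_nhds (0 : ℝ) one_pos] with t ht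
      simpa using ht
    filter_upwards [hc.filter_mono nhdsWithin_le_nhds, hsmall.filter_mono nhdsWithin_le_nhds,
      self_mem_nhdsWithin] with t ht ht1 ht0
    have hpos : 0 < ‖t‖ := norm_pos_iff.2 ht0
    obtain ⟨e, rfl⟩ : ∃ e, m = j + e := ⟨m - j, by omega⟩
    rw [hr] at ht
    simp only [Polynomial.eval_mul, Polynomial.eval_pow, map_zero, sub_zero, Polynomial.eval_X,
      norm_mul, norm_pow] at ht
    have hc0 : 0 ≤ c := by
      by_contra hc0
      have : c * ‖t‖ ^ (j + e + 1) < 0 := mul_neg_of_neg_of_pos (not_le.1 hc0) (by positivity)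
      have : 0 ≤ ‖t‖ ^ j * ‖r.eval t‖ := by positivity
      linarith
    have h2 : ‖t‖ ^ j * ‖r.eval t‖ ≤ ‖t‖ ^ j * (c * ‖t‖ * ‖t‖ ^ e) := by
      refine ht.trans (le_of_eq ?_)
      ring
    refine (le_of_mul_le_mul_left h2 (by positivity)).trans ?_
    exact mul_le_of_le_one_right (by positivity) (pow_le_one₀ hpos.le ht1)
  have h2 : Filter.Tendsto (fun t : ℝ => c * ‖t‖) (𝓝[≠] 0) (𝓝 0) := by
    have : Continuous fun t : ℝ => c * ‖t‖ := by fun_prop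
    simpa using (this.tendsto 0).mono_left (nhdsWithin_le_nhds (s := {0}ᶜ))
  have h3 := squeeze_zero_norm' h1 h2
  exact hnd (tendsto_nhds_unique
    ((r.continuous.tendsto 0).mono_left (nhdsWithin_le_nhds (s := {0}ᶜ))) h3)

theorem eval_mul_eq_sum (p : Poly n) (x : Fin n → ℝ) (t : ℝ) :
    eval (fun i => t * x i) p
      = ∑ k ∈ Finset.range (p.totalDegree + 1), eval x (homogeneousComponent k p) * t ^ k := by
  conv_lhs => rw [← sum_homogeneousComponent p]
  rw [map_sum]
  refine Finset.sum_congr rfl fun k _ => ?_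
  rw [← eval_rescale]
  have : rescale t (homogeneousComponent k p) = C (t ^ k) * homogeneousComponent k p := by
    ext α
    rw [coeff_rescale, coeff_C_mul, coeff_homogeneousComponent]
    split_ifs with h
    · rw [h]
    · simp
  rw [this, map_mul, eval_C, mul_comm]

/-- Restriction to each line through the origin reduces this to one variable. -/
theorem poly_eq_zero_of_isBigO {p : Poly n} {m : ℕ} (hp : p.totalDegree ≤ m)
    (h : (fun x : Pt n => eval (fun a => x a) p) =O[𝓝 0] fun x => ‖x‖ ^ (m + 1)) : p = 0 := by
  refine MvPolynomial.funext fun x => ?_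
  set q : Polynomial ℝ := ∑ k ∈ Finset.range (p.totalDegree + 1),
    Polynomial.C (eval x (homogeneousComponent k p)) * Polynomial.X ^ k with hq
  have hqe : ∀ t, q.eval t = eval (fun i => t * x i) p := fun t => by
    rw [eval_mul_eq_sum, hq, Polynomial.eval_finsetSum]
    simp
  have hdeg : q.natDegree ≤ m := Polynomial.natDegree_sum_le_of_forall_le _ _ fun k hk =>
    (Polynomial.natDegree_C_mul_X_pow_le _ _).trans (by
      have := Finset.mem_range.1 hk
      omega)
  have hq0 : q = 0 := by
    refine polynomial_eq_zero_of_isBigO hdeg ?_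
    set y : Pt n := WithLp.toLp 2 x
    have ht : Filter.Tendsto (fun t : ℝ => t • y) (𝓝 0) (𝓝 0) := by
      have : Continuous fun t : ℝ => t • y := by fun_prop
      simpa using this.tendsto 0
    have h1 := h.comp_tendsto ht
    have h2 : (fun t : ℝ => q.eval t) = (fun x : Pt n => eval (fun a => x a) p) ∘ fun t => t • y :=
      funext fun t => by rw [hqe]; rfl
    rw [h2]
    refine h1.trans (IsBigO.of_bound (‖y‖ ^ (m + 1)) (Filter.Eventually.of_forall fun t => ?_))
    simp only [Function.comp, norm_smul, mul_pow, norm_mul, norm_pow, norm_norm]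
    rw [mul_comm]
  have := hqe 1
  rw [hq0] at this
  simpa using this.symm

/-- Each identity for `H` holds up to an error from `h - H` of higher order than the degree of the
polynomial involved, so it holds exactly. Multiplication by `x` raises both the degree and the order
of the error by one; the trace of `h` is negligible because `d + 1 ≤ 2d + 2`. -/
theorem isRadialFree_of_isTaylorPart {d : ℕ} {ρ : ℝ} {h : Tensor2 n} {H : PolyMatrix n}
    (hh : IsNormalTensor d ρ h) (hH : IsTaylorPart d h H) : IsRadialFree H := by
  have hball : ∀ᶠ x in 𝓝 (0 : Pt n), x ∈ Metric.ball (0 : Pt n) ρ :=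
    Metric.ball_mem_nhds _ hh.radius_pos
  have hdeg : ∀ i j, (H i j).totalDegree ≤ d := fun i j =>
    Finset.sup_le fun α hα => (hH.degree i j α hα).2
  have hsymm : ∀ i j, H i j = H j i := fun i j => by
    refine sub_eq_zero.1 (poly_eq_zero_of_isBigO (m := d)
      ((totalDegree_sub _ _).trans (max_le (hdeg i j) (hdeg j i))) ?_)
    refine ((hH.approx j i).sub (hH.approx i j)).congr' ?_ Filter.EventuallyEq.rfl
    filter_upwards [hball] with x hx
    rw [(hh.symm x hx).apply i j, map_sub]
    simp only [polyTensor, Matrix.of_apply]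
    ring
  refine ⟨hsymm, ?_, fun j => ?_⟩
  · refine poly_eq_zero_of_isBigO (m := d) (totalDegree_finsetSum_le fun i _ => hdeg i i) ?_
    have h1 : (fun x => (h x).trace) =O[𝓝 0] fun x : Pt n => ‖x‖ ^ (d + 1) := by
      refine hh.trace.trans ?_
      refine IsBigO.of_bound 1 ?_
      filter_upwards [Metric.closedBall_mem_nhds (0 : Pt n) one_pos] with x hx
      have hx1 : ‖x‖ ≤ 1 := by simpa using hx
      rw [norm_pow, norm_pow, norm_norm, one_mul]
      exact pow_le_pow_of_le_one (norm_nonneg x) hx1 (by omega)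
    have h2 : (fun x => ∑ i, (h x i i - polyTensor H x i i)) =O[𝓝 0]
        fun x : Pt n => ‖x‖ ^ (d + 1) := IsBigO.fun_sum fun i _ => hH.approx i i
    refine (h1.sub h2).congr_left fun x => ?_
    rw [map_sum, Finset.sum_sub_distrib, Matrix.trace]
    simp [polyTensor]
  · refine poly_eq_zero_of_isBigO (m := d + 1) (totalDegree_finsetSum_le fun i _ =>
      (totalDegree_mul _ _).trans ?_) ?_
    · rw [totalDegree_X, add_comm]
      exact Nat.add_le_add_right (hdeg i j) 1
    · have h1 : ∀ i, (fun x : Pt n => (h x i j - polyTensor H x i j) * x i) =O[𝓝 0]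
          fun x : Pt n => ‖x‖ ^ (d + 1 + 1) := fun i => by
        have hx : (fun x : Pt n => x i) =O[𝓝 0] fun x : Pt n => ‖x‖ :=
          IsBigO.of_bound 1 (Filter.Eventually.of_forall fun x => by
            rw [norm_norm, one_mul]; exact PiLp.norm_apply_le x i)
        exact ((hH.approx i j).mul hx).congr_right fun x => (pow_succ _ _).symm
      have h2 := (IsBigO.fun_sum (s := Finset.univ) fun i _ => h1 i).neg_left
      refine h2.congr' ?_ Filter.EventuallyEq.rfl
      filter_upwards [hball] with x hx
      have h3 := hh.radial x hx j
      simp only [sub_mul, Finset.sum_sub_distrib, map_sum, map_mul, eval_X]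
      have h4 : ∑ i, h x i j * x i = 0 := by
        rw [← h3]
        exact Finset.sum_congr rfl fun i _ => by rw [(hh.symm x hx).apply]
      rw [h4, zero_sub, neg_neg]
      exact Finset.sum_congr rfl fun i _ => by rw [mul_comm]; rfl

/-- An open set contains a product of intervals, and vanishing on a product of infinite sets
determines a polynomial. -/
theorem poly_eq_zero_of_isOpen {U : Set (Pt n)} (hU : IsOpen U) (hne : U.Nonempty) {p : Poly n}
    (h : ∀ x ∈ U, eval (fun a => x a) p = 0) : p = 0 := by
  obtain ⟨x₀, hx₀⟩ := hne
  have hc : Continuous (WithLp.toLp 2 : (Fin n → ℝ) → Pt n) := PiLp.continuous_toLp 2 _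
  obtain ⟨e, he, hb⟩ := Metric.isOpen_iff.1 (hU.preimage hc) (fun a => x₀ a) hx₀
  refine funext_set (fun i => Metric.ball (x₀ i) e)
    (fun i => by rw [Real.ball_eq_Ioo]; exact Set.Ioo_infinite (by linarith)) fun x hx => ?_
  rw [map_zero]
  refine h (WithLp.toLp 2 x) (hb ?_)
  rw [ball_pi _ he]
  exact hx

end Taylor

/-! ### The coercivity estimate on an annulus -/

section Coercivity

open MvPolynomial
open scoped Pointwise

/-- The exponents of degree at most `d`. -/
abbrev Expo (n d : ℕ) : Type := {α : Fin n →₀ ℕ // α.degree ≤ d}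

instance (n d : ℕ) : Fintype (Expo n d) := (Finsupp.finite_of_degree_le d).fintype

/-- The coefficients of the matrices of polynomials of degree at most `d`. -/
abbrev CoeffSpace (n d : ℕ) : Type := Fin n × Fin n × Expo n d → ℝ

variable {d : ℕ}

/-- The matrix of polynomials with given coefficients. -/
def toPoly : CoeffSpace n d →ₗ[ℝ] PolyMatrix n where
  toFun v := Matrix.of fun i j => ∑ α : Expo n d, monomial α.1 (v (i, j, α))
  map_add' v w := by
    ext1 i j
    simp only [Matrix.of_apply, Matrix.add_apply, Pi.add_apply, map_add, Finset.sum_add_distrib]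
  map_smul' c v := by
    ext1 i j
    simp only [Matrix.of_apply, Matrix.smul_apply, Pi.smul_apply, map_smul, Finset.smul_sum,
      RingHom.id_apply]

theorem coeff_toPoly (v : CoeffSpace n d) (i j : Fin n) (α : Fin n →₀ ℕ) :
    coeff α (toPoly v i j) = if h : α.degree ≤ d then v (i, j, ⟨α, h⟩) else 0 := by
  simp only [toPoly, LinearMap.coe_mk, AddHom.coe_mk, Matrix.of_apply, coeff_sum, coeff_monomial]
  split_ifs with h
  · rw [Finset.sum_eq_single ⟨α, h⟩]
    · simp
    · intro β _ hβ
      rw [if_neg fun h1 => hβ (Subtype.ext h1)]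
    · simp
  · refine Finset.sum_eq_zero fun β _ => ?_
    rw [if_neg]
    rintro rfl
    exact h β.2

/-- The coefficients of the admissible polynomial tensors. -/
def admissible (n d : ℕ) : Submodule ℝ (CoeffSpace n d) where
  carrier := {v | IsRadialFree (toPoly v) ∧ ∀ i j (α : Expo n d), α.1.degree < 2 → v (i, j, α) = 0}
  add_mem' := by
    rintro v w ⟨hv, hv'⟩ ⟨hw, hw'⟩
    refine ⟨⟨fun i j => ?_, ?_, fun j => ?_⟩, fun i j α h => ?_⟩
    · simp only [map_add, Matrix.add_apply, hv.symm i j, hw.symm i j]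
    · simp only [map_add, Matrix.add_apply, Finset.sum_add_distrib, hv.trace, hw.trace, add_zero]
    · simp only [map_add, Matrix.add_apply, mul_add, Finset.sum_add_distrib, hv.radial, hw.radial,
        add_zero]
    · rw [Pi.add_apply, hv' i j α h, hw' i j α h, add_zero]
  zero_mem' := by
    refine ⟨⟨fun i j => ?_, ?_, fun j => ?_⟩, fun i j α h => rfl⟩ <;> simp
  smul_mem' := by
    rintro c v ⟨hv, hv'⟩
    refine ⟨⟨fun i j => ?_, ?_, fun j => ?_⟩, fun i j α h => ?_⟩
    · simp only [map_smul, Matrix.smul_apply, hv.symm i j]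
    · simp only [map_smul, Matrix.smul_apply, ← Finset.smul_sum, hv.trace, smul_zero]
    · simp only [map_smul, Matrix.smul_apply, mul_smul_comm, ← Finset.smul_sum, hv.radial,
        smul_zero]
    · rw [Pi.smul_apply, hv' i j α h, smul_zero]

/-- A closed annulus. -/
def annulus (n : ℕ) (r : ℝ) : Set (Pt n) := {x | r ≤ ‖x‖ ∧ ‖x‖ ≤ 5 / 4 * r}

theorem isCompact_annulus (r : ℝ) : IsCompact (annulus n r) := by
  have h : annulus n r = Metric.closedBall 0 (5 / 4 * r) ∩ {x | r ≤ ‖x‖} := by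
    ext x
    simp [annulus, and_comm]
  rw [h]
  exact (isCompact_closedBall _ _).inter_right (isClosed_le continuous_const continuous_norm)

theorem flatWeylSq_nonneg (T : Tensor2 n) (x : Pt n) : 0 ≤ flatWeylSq T x :=
  Finset.sum_nonneg fun _ _ => Finset.sum_nonneg fun _ _ => Finset.sum_nonneg fun _ _ =>
    Finset.sum_nonneg fun _ _ => sq_nonneg _

theorem continuous_flatWeylSq {T : Tensor2 n} (hT : ∀ i j, ContDiff ℝ ∞ fun y => T y i j) :
    Continuous (flatWeylSq T) :=
  continuous_finsetSum _ fun i _ => continuous_finsetSum _ fun j _ =>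
    continuous_finsetSum _ fun k _ => continuous_finsetSum _ fun l _ =>
      (continuous_flatWeyl hT i j k l).pow 2

theorem smooth_polyTensor (H : PolyMatrix n) (i j : Fin n) :
    ContDiff ℝ ∞ fun y => polyTensor H y i j :=
  smooth_eval (H i j)

/-- The energy of a polynomial tensor on an annulus. -/
def annulusEnergy (v : CoeffSpace n d) : ℝ :=
  ∫ x in annulus n 1, flatWeylSq (polyTensor (toPoly v)) x

/-- The Weyl tensor is linear in the coefficients and polynomial in `x`; expanding over the standard
basis of `CoeffSpace` makes the integrand jointly continuous on a compact domain. -/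
theorem continuous_annulusEnergy : Continuous (annulusEnergy : CoeffSpace n d → ℝ) := by
  refine continuous_parametric_integral_of_continuous
    (f := fun v x => flatWeylSq (polyTensor (toPoly v)) x) ?_ (isCompact_annulus 1)
  change Continuous fun p : CoeffSpace n d × Pt n =>
    ∑ i, ∑ j, ∑ k, ∑ l, flatWeyl (polyTensor (toPoly p.1)) p.2 i j k l ^ 2
  refine continuous_finsetSum _ fun i _ => continuous_finsetSum _ fun j _ =>
    continuous_finsetSum _ fun k _ => continuous_finsetSum _ fun l _ => ?_
  have h : ∀ p : CoeffSpace n d × Pt n,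
      flatWeyl (polyTensor (toPoly p.1)) p.2 i j k l
        = ∑ a, p.1 a * eval (fun b => p.2 b)
            (polyWeylLin i j k l (toPoly fun b => if a = b then 1 else 0)) := fun p => by
    rw [flatWeyl_polyTensor]
    change eval _ ((polyWeylLin i j k l ∘ₗ toPoly) p.1) = _
    rw [LinearMap.pi_apply_eq_sum_univ, map_sum]
    simp only [smul_eval]
    rfl
  refine Continuous.congr (Continuous.pow ?_ 2) fun p => congrArg (· ^ 2) (h p).symm
  refine continuous_finsetSum _ fun a _ => Continuous.mul (by fun_prop) ?_
  exact (smooth_eval _).continuous.comp continuous_snd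

theorem annulusEnergy_nonneg (v : CoeffSpace n d) : 0 ≤ annulusEnergy v :=
  integral_nonneg fun _ => flatWeylSq_nonneg _ _

theorem annulusEnergy_smul (c : ℝ) (v : CoeffSpace n d) :
    annulusEnergy (c • v) = c ^ 2 * annulusEnergy v := by
  rw [annulusEnergy, annulusEnergy, ← integral_const_mul]
  congr 1
  ext x
  simp only [flatWeylSq, flatWeyl_polyTensor, map_smul, polyWeyl_smul, smul_eval, mul_pow,
    Finset.mul_sum]

/-- Zero energy makes the continuous integrand vanish on the open annulus, so the polynomial Weyl
tensor vanishes identically and injectivity applies. -/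
theorem annulusEnergy_pos (hn : 4 ≤ n) {v : CoeffSpace n d} (hv : v ∈ admissible n d)
    (h0 : v ≠ 0) : 0 < annulusEnergy v := by
  have hcont := continuous_flatWeylSq (smooth_polyTensor (toPoly v))
  refine lt_of_le_of_ne (annulusEnergy_nonneg v) fun heq => h0 ?_
  have hint : IntegrableOn (flatWeylSq (polyTensor (toPoly v))) (annulus n 1) :=
    hcont.continuousOn.integrableOn_compact (isCompact_annulus 1)
  have hae := (setIntegral_eq_zero_iff_of_nonneg_ae
    (Filter.Eventually.of_forall fun x => flatWeylSq_nonneg _ x) hint).1 heq.symm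
  set U : Set (Pt n) := {x | 1 < ‖x‖ ∧ ‖x‖ < 5 / 4} with hU
  have hUo : IsOpen U := (isOpen_lt continuous_const continuous_norm).inter
    (isOpen_lt continuous_norm continuous_const)
  have hUs : U ⊆ annulus n 1 := fun x hx => ⟨hx.1.le, by linarith [hx.2]⟩
  have hUne : U.Nonempty := by
    refine ⟨EuclideanSpace.single ⟨0, by omega⟩ (9 / 8), ?_⟩
    constructor <;> simp <;> norm_num
  have hz : Set.EqOn (flatWeylSq (polyTensor (toPoly v))) 0 U :=
    Measure.eqOn_open_of_ae_eq (ae_restrict_of_ae_restrict_of_subset hUs hae) hUo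
      hcont.continuousOn continuousOn_const
  have hW : ∀ i j k l, polyWeyl (toPoly v) i j k l = 0 := by
    intro i j k l
    refine poly_eq_zero_of_isOpen hUo hUne fun x hx => ?_
    have h1 := hz hx
    rw [← flatWeyl_polyTensor]
    have h2 : flatWeyl (polyTensor (toPoly v)) x i j k l ^ 2
        ≤ flatWeylSq (polyTensor (toPoly v)) x := by
      have e4 := Finset.single_le_sum (f := fun l => flatWeyl (polyTensor (toPoly v)) x i j k l ^ 2)
        (fun _ _ => sq_nonneg _) (Finset.mem_univ l)
      have e3 := Finset.single_le_sum
        (f := fun k => ∑ l, flatWeyl (polyTensor (toPoly v)) x i j k l ^ 2)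
        (fun _ _ => Finset.sum_nonneg fun _ _ => sq_nonneg _) (Finset.mem_univ k)
      have e2 := Finset.single_le_sum
        (f := fun j => ∑ k, ∑ l, flatWeyl (polyTensor (toPoly v)) x i j k l ^ 2)
        (fun _ _ => Finset.sum_nonneg fun _ _ => Finset.sum_nonneg fun _ _ => sq_nonneg _)
        (Finset.mem_univ j)
      have e1 := Finset.single_le_sum
        (f := fun i => ∑ j, ∑ k, ∑ l, flatWeyl (polyTensor (toPoly v)) x i j k l ^ 2)
        (fun _ _ => Finset.sum_nonneg fun _ _ => Finset.sum_nonneg fun _ _ =>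
          Finset.sum_nonneg fun _ _ => sq_nonneg _) (Finset.mem_univ i)
      exact ((e4.trans e3).trans e2).trans e1
    rw [h1] at h2
    exact pow_eq_zero_iff (two_ne_zero) |>.1 (le_antisymm h2 (sq_nonneg _))
  have hP := eq_zero_of_polyWeyl hn hv.1 (fun i j α hα => by
    by_contra hlt
    rw [mem_support_iff, coeff_toPoly] at hα
    split_ifs at hα with h
    · exact hα (hv.2 i j ⟨α, h⟩ (not_le.1 hlt))
    · exact hα rfl) hW
  ext ⟨i, j, α⟩
  have := coeff_toPoly v i j α.1
  rw [hP, dif_pos α.2] at this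
  simpa using this.symm

/-- The constant is the minimum of the energy on the unit sphere of the admissible space, which is
compact; homogeneity of degree two does the rest. -/
theorem exists_coercivity (hn : 4 ≤ n) (d : ℕ) :
    ∃ c : ℝ, 0 < c ∧ ∀ v ∈ admissible n d, c * ‖v‖ ^ 2 ≤ annulusEnergy v := by
  set S : Set (CoeffSpace n d) := {v | v ∈ admissible n d ∧ ‖v‖ = 1} with hS
  have hcl : IsClosed (admissible n d : Set (CoeffSpace n d)) :=
    Submodule.closed_of_finiteDimensional _
  have hcomp : IsCompact S := by
    have : S = Metric.sphere 0 1 ∩ (admissible n d : Set (CoeffSpace n d)) := by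
      ext v
      simp [hS, and_comm]
    rw [this]
    exact (isCompact_sphere _ _).inter_right hcl
  -- An empty sphere means that the admissible space is zero, and any constant works.
  rcases S.eq_empty_or_nonempty with hE | hne
  · refine ⟨1, one_pos, fun v hv => ?_⟩
    have h0 : v = 0 := by
      by_contra h0
      have : ‖v‖⁻¹ • v ∈ S := ⟨(admissible n d).smul_mem _ hv, by
        rw [norm_smul, norm_inv, norm_norm, inv_mul_cancel₀ (norm_ne_zero_iff.2 h0)]⟩
      rw [hE] at this
      exact this
    rw [h0]
    simpa using annulusEnergy_nonneg (0 : CoeffSpace n d)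
  · obtain ⟨w, hw, hmin⟩ := hcomp.exists_isMinOn hne continuous_annulusEnergy.continuousOn
    have hw0 : w ≠ 0 := by
      rintro rfl
      simpa using hw.2
    refine ⟨annulusEnergy w, annulusEnergy_pos hn hw.1 hw0, fun v hv => ?_⟩
    rcases eq_or_ne v 0 with rfl | h0
    · simpa using annulusEnergy_nonneg (0 : CoeffSpace n d)
    · have hv0 : ‖v‖ ≠ 0 := norm_ne_zero_iff.2 h0
      have hmem : ‖v‖⁻¹ • v ∈ S := ⟨(admissible n d).smul_mem _ hv, by
        rw [norm_smul, norm_inv, norm_norm, inv_mul_cancel₀ hv0]⟩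
      have h1 : annulusEnergy w ≤ annulusEnergy (‖v‖⁻¹ • v) := hmin hmem
      rw [annulusEnergy_smul] at h1
      calc annulusEnergy w * ‖v‖ ^ 2 ≤ ‖v‖⁻¹ ^ 2 * annulusEnergy v * ‖v‖ ^ 2 := by gcongr
        _ = annulusEnergy v := by field_simp

/-- The coefficient norms are controlled by the energy on the unit annulus. -/
theorem exists_le_integral_annulus (hn : 4 ≤ n) (d : ℕ) :
    ∃ c : ℝ, 0 < c ∧ ∀ H : PolyMatrix n, IsRadialFree H →
      (∀ i j, ∀ α ∈ (H i j).support, 2 ≤ α.degree ∧ α.degree ≤ d) →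
      c * ∑ k ∈ Finset.Icc 2 d, coeffSq H k
        ≤ ∫ x in annulus n 1, flatWeylSq (polyTensor H) x := by
  obtain ⟨c, hc, hcoer⟩ := exists_coercivity hn d
  set N : ℝ := ((n * (n * Fintype.card (Expo n d)) : ℕ) : ℝ) with hN
  have hN0 : 0 ≤ N := Nat.cast_nonneg _
  -- `N` counts the coefficients, as `‖v‖` is the supremum norm and `coeffSq` a sum of squares. The
  -- `+ 1` keeps the denominator positive.
  refine ⟨c / (N + 1), by positivity, fun H hH hdeg => ?_⟩
  set v : CoeffSpace n d := fun a => coeff a.2.2.1 (H a.1 a.2.1) with hv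
  have hvH : toPoly v = H := by
    ext i j α
    rw [coeff_toPoly]
    split_ifs with h
    · rfl
    · by_contra h1
      exact h (hdeg i j α (mem_support_iff.2 (Ne.symm h1))).2
  have hadm : v ∈ admissible n d := by
    refine ⟨by rwa [hvH], fun i j α h => ?_⟩
    by_contra h1
    exact absurd (hdeg i j α.1 (mem_support_iff.2 h1)).1 (not_le.2 h)
  have h1 := hcoer v hadm
  rw [annulusEnergy, hvH] at h1
  have hsum : ∑ k ∈ Finset.Icc 2 d, coeffSq H k ≤ N * ‖v‖ ^ 2 := by
    have h2 : ∑ k ∈ Finset.Icc 2 d, coeffSq H k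
        = ∑ i, ∑ j, ∑ α ∈ (H i j).support, coeff α (H i j) ^ 2 := by
      simp only [coeffSq]
      rw [Finset.sum_comm]
      refine Finset.sum_congr rfl fun i _ => ?_
      rw [Finset.sum_comm]
      refine Finset.sum_congr rfl fun j _ => ?_
      exact Finset.sum_fiberwise_of_maps_to (fun α hα => Finset.mem_Icc.2 (hdeg i j α hα)) _
    have h3 : ∀ i j, ∑ α ∈ (H i j).support, coeff α (H i j) ^ 2
        ≤ Fintype.card (Expo n d) * ‖v‖ ^ 2 := by
      intro i j
      have hcard : (H i j).support.card ≤ Fintype.card (Expo n d) := by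
        have := Finset.card_le_card_of_injOn (s := (H i j).support.attach)
          (t := (Finset.univ : Finset (Expo n d)))
          (fun α => ⟨α.1, (hdeg i j α.1 α.2).2⟩) (fun _ _ => Finset.mem_univ _)
          (fun a _ b _ hab => Subtype.ext (by simpa using hab))
        simpa using this
      calc ∑ α ∈ (H i j).support, coeff α (H i j) ^ 2
          ≤ ∑ _α ∈ (H i j).support, ‖v‖ ^ 2 := by
            refine Finset.sum_le_sum fun α hα => ?_
            have h4 := norm_le_pi_norm v (i, j, ⟨α, (hdeg i j α hα).2⟩)
            rw [← sq_abs]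
            exact pow_le_pow_left₀ (abs_nonneg _) h4 2
        _ = (H i j).support.card * ‖v‖ ^ 2 := by rw [Finset.sum_const, nsmul_eq_mul]
        _ ≤ _ := by gcongr
    rw [h2]
    calc ∑ i, ∑ j, ∑ α ∈ (H i j).support, coeff α (H i j) ^ 2
        ≤ ∑ _i : Fin n, ∑ _j : Fin n, (Fintype.card (Expo n d) * ‖v‖ ^ 2 : ℝ) :=
          Finset.sum_le_sum fun i _ => Finset.sum_le_sum fun j _ => h3 i j
      _ = N * ‖v‖ ^ 2 := by
          simp only [Finset.sum_const, Finset.card_univ, Fintype.card_fin, nsmul_eq_mul, hN]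
          push_cast
          ring
  calc c / (N + 1) * ∑ k ∈ Finset.Icc 2 d, coeffSq H k
      ≤ c / (N + 1) * (N * ‖v‖ ^ 2) := by gcongr
    _ = c * ‖v‖ ^ 2 * (N / (N + 1)) := by ring
    _ ≤ c * ‖v‖ ^ 2 * 1 := by
        gcongr
        rw [div_le_one (by positivity)]
        linarith
    _ ≤ _ := by rwa [mul_one]

/-- The scaled coercivity estimate. -/
theorem le_integral_annulus_of_unit {c : ℝ} {H : PolyMatrix n} {d : ℕ}
    (hc : ∀ H : PolyMatrix n, IsRadialFree H →
      (∀ i j, ∀ α ∈ (H i j).support, 2 ≤ α.degree ∧ α.degree ≤ d) →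
      c * ∑ k ∈ Finset.Icc 2 d, coeffSq H k
        ≤ ∫ x in annulus n 1, flatWeylSq (polyTensor H) x)
    (hH : IsRadialFree H)
    (hdeg : ∀ i j, ∀ α ∈ (H i j).support, 2 ≤ α.degree ∧ α.degree ≤ d) {r : ℝ} (hr : 0 < r) :
    c * ∑ k ∈ Finset.Icc 2 d, coeffSq H k * r ^ ((n : ℤ) + 2 * k - 4)
      ≤ ∫ x in annulus n r, flatWeylSq (polyTensor H) x := by
  have h1 := hc _ (hH.rescale hr.ne') fun i j α hα =>
    hdeg i j α (support_rescale_subset r (H i j) hα)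
  simp only [coeffSq_rescale hr.ne', flatWeylSq_rescale] at h1
  -- The change of variables contributes `r^(-n)`; with `r⁴` from the derivatives and `r^(2k)` from
  -- the coefficients this yields the exponent `n + 2k - 4`.
  rw [integral_const_mul, Measure.setIntegral_comp_smul_of_pos _ _ _ hr, finrank_euclideanSpace,
    Fintype.card_fin, smul_eq_mul] at h1
  have hset : r • annulus n 1 = annulus n r := by
    ext x
    rw [Set.mem_smul_set_iff_inv_smul_mem₀ hr.ne']
    simp only [annulus, Set.mem_ofPred_eq, norm_smul, norm_inv, Real.norm_of_nonneg hr.le]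
    rw [le_inv_mul_iff₀ hr, inv_mul_le_iff₀ hr]
    constructor <;> rintro ⟨h1, h2⟩ <;> constructor <;> linarith
  rw [hset] at h1
  have h2 : c * ∑ k ∈ Finset.Icc 2 d, coeffSq H k * r ^ ((n : ℤ) + 2 * k - 4)
      = r ^ n * (r ^ 4)⁻¹ * (c * ∑ k ∈ Finset.Icc 2 d, r ^ (2 * k) * coeffSq H k) := by
    rw [mul_left_comm _ c, Finset.mul_sum (a := r ^ n * (r ^ 4)⁻¹)]
    congr 1
    refine Finset.sum_congr rfl fun k _ => ?_
    rw [zpow_sub₀ hr.ne', zpow_add₀ hr.ne', zpow_natCast]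
    have e1 : r ^ (2 * (k : ℤ)) = r ^ (2 * k) := by
      rw [← zpow_natCast]; push_cast; rfl
    have e2 : r ^ (4 : ℤ) = r ^ 4 := by norm_cast
    rw [e1, e2]
    ring
  rw [h2]
  calc r ^ n * (r ^ 4)⁻¹ * (c * ∑ k ∈ Finset.Icc 2 d, r ^ (2 * k) * coeffSq H k)
      ≤ r ^ n * (r ^ 4)⁻¹ * (r ^ 4 * ((r ^ n)⁻¹
        * ∫ x in annulus n r, flatWeylSq (polyTensor H) x)) := by gcongr
    _ = _ := by field_simp

end Coercivity

/-! ### The weighted integral estimates -/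

theorem coeffSq_nonneg (H : PolyMatrix n) (k : ℕ) : 0 ≤ coeffSq H k :=
  Finset.sum_nonneg fun _ _ => Finset.sum_nonneg fun _ _ => Finset.sum_nonneg fun _ _ => sq_nonneg _

/-! ### Replacement of `T` by the cut-off polynomial tensor -/

section Splitting

variable {ε δ : ℝ} {χ : ℝ → ℝ} {H : PolyMatrix n} {X : Pt n → Pt n} {T S : Tensor2 n}

/-- The cut-off polynomial tensor. -/
def cutoffTensor (δ : ℝ) (χ : ℝ → ℝ) (H : PolyMatrix n) : Tensor2 n :=
  fun x => χ (‖x‖ / δ) • polyTensor H x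

theorem cutoffTensor_eq (hχ : IsCutoff χ) (hδ : 0 < δ) {x : Pt n} (hx : ‖x‖ ≤ 4 / 3 * δ) :
    cutoffTensor δ χ H x = polyTensor H x := by
  rw [cutoffTensor, hχ.one _ ((div_le_iff₀ hδ).2 hx), one_smul]

theorem smooth_cutoffTensor (hχ : IsCutoff χ) (hδ : 0 < δ) (i j : Fin n) :
    ContDiff ℝ ∞ fun y => cutoffTensor δ χ H y i j := by
  have h : ContDiff ℝ ∞ fun y : Pt n => χ (‖y‖ / δ) := by
    rw [contDiff_iff_contDiffAt]
    intro x
    -- The norm is not smooth at the origin, but the cutoff is constant there.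
    rcases eq_or_ne x 0 with rfl | hx
    · refine contDiffAt_const.congr_of_eventuallyEq (f := fun _ => (1 : ℝ)) ?_
      filter_upwards [Metric.ball_mem_nhds (0 : Pt n) hδ] with y hy
      have hy' : ‖y‖ < δ := by simpa using hy
      exact hχ.one _ ((div_le_iff₀ hδ).2 (by linarith))
    · exact hχ.smooth.contDiffAt.comp x ((contDiffAt_norm ℝ hx).div_const δ)
  simp only [cutoffTensor, Matrix.smul_apply, smul_eq_mul]
  exact h.mul (smooth_polyTensor H i j)

theorem flatWeylSq_cutoffTensor (hχ : IsCutoff χ) (hδ : 0 < δ) {x : Pt n}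
    (hx : ‖x‖ < 4 / 3 * δ) :
    flatWeylSq (cutoffTensor δ χ H) x = flatWeylSq (polyTensor H) x := by
  have h : cutoffTensor δ χ H =ᶠ[𝓝 x] polyTensor H := by
    filter_upwards [(isOpen_lt continuous_norm continuous_const).mem_nhds hx] with y hy
    exact cutoffTensor_eq hχ hδ (le_of_lt hy)
  simp only [flatWeylSq, flatWeyl_congr h]

/-- Smoothness and symmetry of `T` come from `T = χ_δ H - S`. As the flat Weyl operator kills `S`,
the right-hand side no longer involves the splitting. -/
theorem volIntegral_eq (hn : 5 ≤ n) (hχ : IsCutoff χ) (hε : 0 < ε) (hδ : 0 < δ)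
    (hH : IsRadialFree H) (hs : IsSplitting ε δ χ (polyTensor H) X T S) (U : Set (Pt n)) :
    volIntegral (roundMetric n ε) U
        (fun x => normSq4 (roundMetric n ε) x (linWeyl (roundMetric n ε) (bubbleScale ε T) x))
      = ∫ x in U, (ε / (ε ^ 2 + ‖x‖ ^ 2)) ^ (n - 4) * flatWeylSq (cutoffTensor δ χ H) x := by
  have hSsm : ∀ i j, ContDiff ℝ ∞ fun y => S y i j := fun i j => by
    rw [hs.eq_S]
    exact smooth_conformalKilling hs.smooth i j
  have hT : T = fun y => cutoffTensor δ χ H y - S y := funext fun y => by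
    rw [cutoffTensor, hs.split y, add_sub_cancel_right]
  have hTsm : ∀ i j, ContDiff ℝ ∞ fun y => T y i j := fun i j => by
    rw [hT]
    exact (smooth_cutoffTensor hχ hδ i j).sub (hSsm i j)
  have hTs : ∀ y, (T y).IsSymm := fun y => by
    rw [hT, hs.eq_S]
    refine Matrix.IsSymm.sub (Matrix.IsSymm.smul (Matrix.IsSymm.ext fun i j => ?_) _)
      (conformalKilling_isSymm X y)
    simp only [polyTensor, Matrix.of_apply, hH.symm j i]
  have hflat : ∀ x, flatWeylSq (cutoffTensor δ χ H) x = flatWeylSq T x := fun x => by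
    have h1 : cutoffTensor δ χ H = fun y => T y + S y := funext fun y => hs.split y
    simp only [flatWeylSq]
    rw [h1]
    simp only [flatWeyl_add hTsm hSsm]
    rw [hs.eq_S]
    simp only [flatWeyl_conformalKilling (by omega : 3 ≤ n) hs.smooth, add_zero]
  simp only [volIntegral, integrand_eq hn hε hTsm hTs, hflat]

end Splitting

/-! ### Bounds on annuli and dyadic summation -/

section Estimates

variable {ε δ : ℝ} {χ : ℝ → ℝ} {H : PolyMatrix n}

/-- The integrand of the weighted energy. -/
def energyDensity (ε δ : ℝ) (χ : ℝ → ℝ) (H : PolyMatrix n) (x : Pt n) : ℝ :=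
  (ε / (ε ^ 2 + ‖x‖ ^ 2)) ^ (n - 4) * flatWeylSq (cutoffTensor δ χ H) x

theorem energyDensity_nonneg (hε : 0 < ε) (x : Pt n) : 0 ≤ energyDensity ε δ χ H x :=
  mul_nonneg (by positivity) (flatWeylSq_nonneg _ _)

theorem continuous_energyDensity (hχ : IsCutoff χ) (hε : 0 < ε) (hδ : 0 < δ) :
    Continuous (energyDensity ε δ χ H) := by
  have h : ∀ x : Pt n, ε ^ 2 + ‖x‖ ^ 2 ≠ 0 := fun x => by positivity
  refine Continuous.mul (Continuous.pow (continuous_const.div (by fun_prop) h) _) ?_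
  exact continuous_flatWeylSq (smooth_cutoffTensor hχ hδ)

theorem integrableOn_of_continuous {f : Pt n → ℝ} (hf : Continuous f) {D : Set (Pt n)} {R : ℝ}
    (hD : D ⊆ Metric.ball 0 R) : IntegrableOn f D :=
  (hf.continuousOn.integrableOn_compact (isCompact_closedBall (0 : Pt n) R)).mono_set
    (hD.trans Metric.ball_subset_closedBall)

/-- On the annulus `ε² + |x|² ≤ 4 s² + (25/16) s² ≤ 6 s²`, whence the constant `6^(n-4)`. The weak
requirement `ε ≤ 2 s` leaves room for the innermost ball of the dyadic decomposition, where `s` may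
be smaller than `ε`. -/
theorem le_integral_of_annulus_subset (hχ : IsCutoff χ) (hε : 0 < ε) (hδ : 0 < δ) (hn : 4 ≤ n)
    {c : ℝ} {d : ℕ} {s : ℝ} (hs : 0 < s) (hεs : ε ≤ 2 * s) (hsδ : s ≤ δ)
    (hc : c * ∑ k ∈ Finset.Icc 2 d, coeffSq H k * s ^ ((n : ℤ) + 2 * k - 4)
      ≤ ∫ x in annulus n s, flatWeylSq (polyTensor H) x)
    {D : Set (Pt n)} {R : ℝ} (hD : D ⊆ Metric.ball 0 R)
    (hsub : annulus n s ⊆ D) :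
    c / 6 ^ (n - 4) * ε ^ (n - 4)
        * ∑ k ∈ Finset.Icc 2 d, coeffSq H k * s ^ (-(n : ℤ) + 2 * k + 4)
      ≤ ∫ x in D, energyDensity ε δ χ H x := by
  have hF := continuous_energyDensity (H := H) hχ hε hδ
  have h1 : ∫ x in annulus n s, (ε / (6 * s ^ 2)) ^ (n - 4) * flatWeylSq (polyTensor H) x
      ≤ ∫ x in annulus n s, energyDensity ε δ χ H x := by
    refine setIntegral_mono_on ?_ ?_ (isCompact_annulus s).measurableSet fun x hx => ?_
    · exact ((continuous_flatWeylSq (smooth_polyTensor H)).continuousOn.integrableOn_compact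
        (isCompact_annulus s)).const_mul _
    · exact hF.continuousOn.integrableOn_compact (isCompact_annulus s)
    · obtain ⟨hx1, hx2⟩ := hx
      -- The outer radius `5/4 · s` was chosen below `4/3 · δ`, inside the region where the cutoff
      -- equals `1`.
      rw [energyDensity, flatWeylSq_cutoffTensor hχ hδ (by linarith)]
      refine mul_le_mul_of_nonneg_right ?_ (flatWeylSq_nonneg _ _)
      refine pow_le_pow_left₀ (by positivity) ?_ _
      refine div_le_div_of_nonneg_left hε.le (by positivity) ?_
      have h2 : ‖x‖ ^ 2 ≤ (5 / 4 * s) ^ 2 := pow_le_pow_left₀ (norm_nonneg x) hx2 2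
      have h3 : ε ^ 2 ≤ (2 * s) ^ 2 := pow_le_pow_left₀ hε.le hεs 2
      nlinarith [sq_nonneg s]
  have h2 : ∫ x in annulus n s, energyDensity ε δ χ H x ≤ ∫ x in D, energyDensity ε δ χ H x :=
    setIntegral_mono_set (integrableOn_of_continuous hF hD)
      (Filter.Eventually.of_forall fun x => energyDensity_nonneg hε x)
      (Filter.Eventually.of_forall hsub)
  refine le_trans ?_ (h1.trans h2)
  rw [integral_const_mul]
  refine le_trans (le_of_eq ?_) (mul_le_mul_of_nonneg_left hc (by positivity))
  rw [Finset.mul_sum, Finset.mul_sum, Finset.mul_sum]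
  refine Finset.sum_congr rfl fun k _ => ?_
  have e : s ^ ((n : ℤ) + 2 * k - 4) = s ^ (-(n : ℤ) + 2 * k + 4) * (s ^ 2) ^ (n - 4) := by
    rw [← pow_mul, ← zpow_natCast, ← zpow_add₀ hs.ne']
    congr 1
    push_cast [Nat.cast_sub hn]
    ring
  rw [e, div_pow, mul_pow]
  field_simp

theorem measureReal_unitBall_pos (n : ℕ) : 0 < volume.real (Metric.ball (0 : Pt n) 1) :=
  ENNReal.toReal_pos (Metric.measure_ball_pos _ _ one_pos).ne' measure_ball_lt_top.ne

theorem continuous_weight (hε : 0 < ε) (z : ℤ) : Continuous fun x : Pt n => (ε + ‖x‖) ^ z := by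
  refine Continuous.zpow₀ (by fun_prop) z fun x => Or.inl ?_
  have := norm_nonneg x
  positivity

/-- The exponent is `-2q` with `q = n - k - 2 ≥ 0`, so the weight is at most its value at `2s/3`.
Multiplying by the volume of the ball of radius `2s` gives `(3/2)^(2q) · 2^n ≤ (9/2)^n`. -/
theorem setIntegral_weight_le (hε : 0 < ε) {k : ℕ} (hk : k + 2 ≤ n) {s : ℝ} (hs : 0 < s)
    {D : Set (Pt n)} (hD : D ⊆ Metric.ball 0 (2 * s)) (hw : ∀ x ∈ D, 2 / 3 * s ≤ ε + ‖x‖) :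
    ∫ x in D, (ε + ‖x‖) ^ (-2 * (n : ℤ) + 2 * k + 4)
      ≤ (9 / 2) ^ n * volume.real (Metric.ball (0 : Pt n) 1) * s ^ (-(n : ℤ) + 2 * k + 4) := by
  obtain ⟨q, hq⟩ : ∃ q, n = k + 2 + q := ⟨n - (k + 2), by omega⟩
  have hexp : -2 * (n : ℤ) + 2 * k + 4 = -((2 * q : ℕ) : ℤ) := by
    rw [hq]; push_cast; ring
  have hpow : ∀ y : ℝ, y ^ (-2 * (n : ℤ) + 2 * k + 4) = (y ^ (2 * q))⁻¹ := fun y => by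
    rw [hexp, zpow_neg, zpow_natCast]
  have hfin : volume D < ⊤ := (measure_mono hD).trans_lt measure_ball_lt_top
  have h1 : ‖∫ x in D, (ε + ‖x‖) ^ (-2 * (n : ℤ) + 2 * k + 4)‖
      ≤ ((2 / 3 * s) ^ (2 * q))⁻¹ * volume.real D := by
    refine norm_setIntegral_le_of_norm_le_const hfin fun x hx => ?_
    have := norm_nonneg x
    rw [hpow, Real.norm_of_nonneg (by positivity)]
    exact inv_anti₀ (by positivity) (pow_le_pow_left₀ (by positivity) (hw x hx) _)
  have h2 : volume.real D ≤ (2 * s) ^ n * volume.real (Metric.ball (0 : Pt n) 1) := by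
    refine (measureReal_mono hD measure_ball_lt_top.ne).trans (le_of_eq ?_)
    rw [Measure.real, Measure.addHaar_ball_of_pos _ _ (by positivity : 0 < 2 * s), ENNReal.toReal_mul,
      ENNReal.toReal_ofReal (by positivity), finrank_euclideanSpace, Fintype.card_fin,
      Measure.real]
  refine (Real.le_norm_self _).trans (h1.trans ?_)
  calc ((2 / 3 * s) ^ (2 * q))⁻¹ * volume.real D
      ≤ ((2 / 3 * s) ^ (2 * q))⁻¹ * ((2 * s) ^ n * volume.real (Metric.ball (0 : Pt n) 1)) := by
        gcongr
    _ = (3 / 2) ^ (2 * q) * 2 ^ n * volume.real (Metric.ball (0 : Pt n) 1)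
        * (s ^ n * (s ^ (2 * q))⁻¹) := by
        have e : (2 / 3 : ℝ) ^ (2 * q) * (3 / 2) ^ (2 * q) = 1 := by
          rw [← mul_pow]; norm_num
        rw [mul_pow, mul_pow, mul_inv, ← eq_inv_of_mul_eq_one_right e]
        ring
    _ ≤ (3 / 2) ^ (2 * n) * 2 ^ n * volume.real (Metric.ball (0 : Pt n) 1)
        * (s ^ n * (s ^ (2 * q))⁻¹) := by
        gcongr
        · norm_num
        · omega
    _ = _ := by
        have e1 : s ^ (-(n : ℤ) + 2 * k + 4) = s ^ n * (s ^ (2 * q))⁻¹ := by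
          rw [← zpow_natCast, ← zpow_natCast, ← zpow_neg, ← zpow_add₀ hs.ne']
          congr 1
          rw [hq]; push_cast; ring
        rw [e1, pow_mul, ← mul_pow]
        norm_num

/-- The lower bound for the energy on all balls of radius between `ε` and `δ`, by dyadic
decomposition. -/
theorem le_integral_ball (hχ : IsCutoff χ) (hε : 0 < ε) (hδ : 0 < δ) (hn : 4 ≤ n)
    {c : ℝ} (hc0 : 0 < c) {d : ℕ} (hd : d + 2 ≤ n)
    (hc : ∀ s : ℝ, 0 < s → c * ∑ k ∈ Finset.Icc 2 d, coeffSq H k * s ^ ((n : ℤ) + 2 * k - 4)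
      ≤ ∫ x in annulus n s, flatWeylSq (polyTensor H) x) (m : ℕ) :
    ∀ R : ℝ, ε ≤ R → R ≤ 2 ^ (m + 1) * ε → R ≤ δ →
      c / 6 ^ (n - 4) / ((9 / 2) ^ n * volume.real (Metric.ball (0 : Pt n) 1)) * ε ^ (n - 4)
        * ∑ k ∈ Finset.Icc 2 d, coeffSq H k *
          ∫ x in Metric.ball (0 : Pt n) R, (ε + ‖x‖) ^ (-2 * (n : ℤ) + 2 * k + 4)
      ≤ ∫ x in Metric.ball (0 : Pt n) R, energyDensity ε δ χ H x := by
  set vol := volume.real (Metric.ball (0 : Pt n) 1) with hvol_def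
  have hvol : 0 < vol := measureReal_unitBall_pos n
  have hF := continuous_energyDensity (H := H) hχ hε hδ
  -- On a region of scale `s` containing the annulus of that scale, the energy is bounded below and
  -- the weight integral above by the same power of `s`. Both sides of the result are additive in
  -- `D`, so the constant survives the summation.
  have piece : ∀ (D : Set (Pt n)) (s : ℝ), 0 < s → D ⊆ Metric.ball 0 (2 * s) →
      (∀ x ∈ D, 2 / 3 * s ≤ ε + ‖x‖) → annulus n s ⊆ D → ε ≤ 2 * s → s ≤ δ →
      c / 6 ^ (n - 4) / ((9 / 2) ^ n * vol) * ε ^ (n - 4)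
        * ∑ k ∈ Finset.Icc 2 d, coeffSq H k *
          ∫ x in D, (ε + ‖x‖) ^ (-2 * (n : ℤ) + 2 * k + 4)
      ≤ ∫ x in D, energyDensity ε δ χ H x := by
    intro D s hs hD hw hsub hεs hsδ
    refine le_trans ?_ (le_integral_of_annulus_subset hχ hε hδ hn hs hεs hsδ (hc s hs) hD hsub)
    calc c / 6 ^ (n - 4) / ((9 / 2) ^ n * vol) * ε ^ (n - 4)
        * ∑ k ∈ Finset.Icc 2 d, coeffSq H k *
          ∫ x in D, (ε + ‖x‖) ^ (-2 * (n : ℤ) + 2 * k + 4)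
        ≤ c / 6 ^ (n - 4) / ((9 / 2) ^ n * vol) * ε ^ (n - 4)
          * ∑ k ∈ Finset.Icc 2 d, coeffSq H k *
            ((9 / 2) ^ n * vol * s ^ (-(n : ℤ) + 2 * k + 4)) := by
          gcongr with k hk
          · exact coeffSq_nonneg H k
          · refine setIntegral_weight_le hε ?_ hs hD hw
            have := (Finset.mem_Icc.1 hk).2
            omega
      _ = _ := by
          simp only [mul_left_comm (coeffSq H _), ← Finset.mul_sum]
          field_simp
  induction m with
  | zero =>
    intro R hR1 hR2 hR3
    have hR : 0 < R := hε.trans_le hR1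
    -- For `ε ≤ R ≤ 2ε` the whole ball is one piece: with `s = 3R/4` the annulus ends at `15R/16 <
    -- R`, and `2s/3 = R/2 ≤ ε`.
    refine piece _ (3 / 4 * R) (by positivity)
      (Metric.ball_subset_ball (by linarith)) (fun x _ => ?_) (fun x hx => ?_) (by linarith)
      (by linarith)
    · have := norm_nonneg x
      norm_num at hR2
      linarith
    · have := hx.2
      rw [mem_ball_zero_iff]
      linarith
  | succ m ih =>
    intro R hR1 hR2 hR3
    by_cases hcase : R ≤ 2 ^ (m + 1) * ε
    · exact ih R hR1 hcase hR3
    · rw [not_le] at hcase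
      have h2m : (1 : ℝ) ≤ 2 ^ m := one_le_pow₀ (by norm_num)
      have hpow : (2 : ℝ) ^ (m + 1) = 2 * 2 ^ m := by ring
      have hpow2 : (2 : ℝ) ^ (m + 1 + 1) = 2 * (2 * 2 ^ m) := by ring
      have hεm : ε ≤ 2 ^ m * ε := le_mul_of_one_le_left hε.le h2m
      rw [hpow] at hcase
      rw [hpow2] at hR2
      have hr : 0 < R / 2 := by linarith
      -- Since `R > 2^(m+1) ε`, half the radius is still at least `ε`; the outer shell is a piece of
      -- scale `R/2`.
      have hA := ih (R / 2) (by linarith) (by rw [hpow]; linarith) (by linarith)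
      have hB := piece (Metric.ball 0 R \ Metric.ball 0 (R / 2)) (R / 2) hr
        (Set.sdiff_subset.trans (Metric.ball_subset_ball (by linarith)))
        (fun x hx => by
          have := hx.2
          rw [mem_ball_zero_iff, not_lt] at this
          linarith)
        (fun x hx => by
          refine ⟨?_, ?_⟩
          · have := hx.2
            rw [mem_ball_zero_iff]
            linarith
          · rw [mem_ball_zero_iff, not_lt]
            exact hx.1)
        (by linarith) (by linarith)
      have hadd : ∀ f : Pt n → ℝ, Continuous f → ∫ x in Metric.ball (0 : Pt n) R, f x
          = (∫ x in Metric.ball (0 : Pt n) (R / 2), f x)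
            + ∫ x in Metric.ball (0 : Pt n) R \ Metric.ball 0 (R / 2), f x := fun f hf => by
        rw [← setIntegral_union Set.disjoint_sdiff_right
          (measurableSet_ball.diff measurableSet_ball)
          (integrableOn_of_continuous hf subset_rfl)
          (integrableOn_of_continuous hf Set.sdiff_subset),
          Set.union_sdiff_cancel (Metric.ball_subset_ball (by linarith))]
      rw [hadd _ hF]
      refine le_trans (le_of_eq ?_) (add_le_add hA hB)
      rw [← mul_add, ← Finset.sum_add_distrib]
      congr 1
      refine Finset.sum_congr rfl fun k _ => ?_
      rw [← mul_add, hadd _ (continuous_weight hε _)]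

end Estimates

end WeylBubble

end

/-! ### The two lower bounds -/

open WeylBubble
theorem proposition4 (n : ℕ) (hn : 8 ≤ n) :
    ∃ C : ℝ, 0 < C ∧
      ∀ (ρ : ℝ) (h : Tensor2 n) (H : Matrix (Fin n) (Fin n) (MvPolynomial (Fin n) ℝ)),
        IsNormalTensor ((n - 4) / 2) ρ h → IsTaylorPart ((n - 4) / 2) h H →
      ∀ χ : ℝ → ℝ, IsCutoff χ →
      ∀ ε δ : ℝ, 0 < ε → 0 < δ →
      ∀ (X : Pt n → Pt n) (T S : Tensor2 n), IsSplitting ε δ χ (polyTensor H) X T S →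
        (∀ r : ℝ, ε < r → r ≤ δ →
          volIntegral (roundMetric n ε) (Metric.ball 0 (2 * r) \ Metric.ball 0 r)
              (fun x => normSq4 (roundMetric n ε) x
                (linWeyl (roundMetric n ε) (bubbleScale ε T) x))
            ≥ 1 / C * ε ^ (n - 4) * ∑ k ∈ Finset.Icc 2 ((n - 4) / 2),
                coeffSq H k * r ^ (-(n : ℤ) + 2 * k + 4)) ∧
        (2 * ε ≤ δ →
          volIntegral (roundMetric n ε) (Metric.ball 0 δ)
              (fun x => normSq4 (roundMetric n ε) x
                (linWeyl (roundMetric n ε) (bubbleScale ε T) x))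
            ≥ 1 / C * ε ^ (n - 4) * ∑ k ∈ Finset.Icc 2 ((n - 4) / 2),
                coeffSq H k *
                  ∫ x in Metric.ball (0 : Pt n) δ, (ε + ‖x‖) ^ (-2 * (n : ℤ) + 2 * k + 4)) := by
  set d := (n - 4) / 2 with hd
  obtain ⟨c, hc, hunit⟩ := exists_le_integral_annulus (show 4 ≤ n by omega) d
  have hω : 0 < volume.real (Metric.ball (0 : Pt n) 1) := measureReal_unitBall_pos n
  -- `c₁` serves the annuli and `c₂` the ball. Both depend only on `n`, because `c` comes from the
  -- unit annulus and `d` is a function of `n`.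
  set c₁ : ℝ := c / 6 ^ (n - 4) with hc₁
  set c₂ : ℝ := c / 6 ^ (n - 4) / ((9 / 2) ^ n * volume.real (Metric.ball (0 : Pt n) 1)) with hc₂
  have hmin : 0 < min c₁ c₂ := lt_min (by positivity) (by positivity)
  refine ⟨(min c₁ c₂)⁻¹, inv_pos.2 hmin, ?_⟩
  intro ρ h H hh hH χ hχ ε δ hε hδ X T S hs
  have hrf := isRadialFree_of_isTaylorPart hh hH
  have hann : ∀ s : ℝ, 0 < s →
      c * ∑ k ∈ Finset.Icc 2 d, coeffSq H k * s ^ ((n : ℤ) + 2 * k - 4)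
        ≤ ∫ x in annulus n s, flatWeylSq (polyTensor H) x :=
    fun s hs => le_integral_annulus_of_unit hunit hrf hH.degree hs
  simp only [volIntegral_eq (by omega : 5 ≤ n) hχ hε hδ hrf hs, one_div, inv_inv, ge_iff_le]
  constructor
  · intro r hr hrδ
    have hr0 : 0 < r := hε.trans hr
    refine le_trans ?_ (le_integral_of_annulus_subset (R := 2 * r) hχ hε hδ (by omega) hr0
      (by linarith) hrδ (hann r hr0) Set.sdiff_subset
      (fun x hx => ⟨?_, ?_⟩))
    · have : 0 ≤ ∑ k ∈ Finset.Icc 2 d, coeffSq H k * r ^ (-(n : ℤ) + 2 * k + 4) :=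
        Finset.sum_nonneg fun k _ => mul_nonneg (coeffSq_nonneg H k) (by positivity)
      gcongr
      exact min_le_left _ _
    · have := hx.2
      rw [mem_ball_zero_iff]
      linarith
    · rw [mem_ball_zero_iff, not_lt]
      exact hx.1
  · intro hεδ
    -- Enough dyadic steps to reach radius `δ` from `ε`; the constant does not depend on their
    -- number.
    obtain ⟨m, hm⟩ := pow_unbounded_of_one_lt (δ / ε) (one_lt_two (α := ℝ))
    rw [div_lt_iff₀ hε] at hm
    refine le_trans ?_ (le_integral_ball hχ hε hδ (by omega) hc (by omega) hann m δ (by linarith)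
      ?_ le_rfl)
    · have : 0 ≤ ∑ k ∈ Finset.Icc 2 d, coeffSq H k *
          ∫ x in Metric.ball (0 : Pt n) δ, (ε + ‖x‖) ^ (-2 * (n : ℤ) + 2 * k + 4) :=
        Finset.sum_nonneg fun k _ => mul_nonneg (coeffSq_nonneg H k)
          (integral_nonneg fun x => by positivity)
      gcongr
      exact min_le_right _ _
    · rw [pow_succ]
      have : 0 < 2 ^ m * ε := by positivity
      linarith
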